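/- Let $K$ be an infinite field, let $t \ge 1$ be an integer, let $R = K[w,x,y,z]$ with the standard grading, and set $A = R/\overline{I_t}$, where \[ \overline{I_t} := \left(\prod_{i=0}^{t}(x-iw),\ \prod_{i=0}^{t}(y-iw),\ \prod_{i=0}^{t}(z-iw),\ xyz\right) \subset R . \] An Artinian standard graded $K$-algebra $B$ has the weak Lefschetz property if there is a linear form $L \in [B]_1$ such that for every integer $d$ the multiplication map $\times L : [B]_d \to [B]_{d+1}$ is injective or surjective. It is level of type $\tau$ if its socle has $K$-dimension $\tau$ and is concentrated in one degree. A finite set of points $Z \subset \mathbb{P}^3_K$ with homogeneous ideal $I_Z$ is level of type $\tau$ if there is a linear form that is a non-zero-divisor on $R/I_Z$, and for every such linear form $h$ the algebra $R/(I_Z,h)$ is Artinian and level of type $\tau$. Then: (i) If $\operatorname{char} K$ is $0$ or greater than $t$, then $\overline{I_t}$ is the homogeneous ideal of its zero set in $\mathbb{P}^3_K$, and this zero set is a set of $3t(t+1)+1$ points that is level of type three. (ii) For a general linear form $\ell \in [R]_1$ (that is, for all $\ell$ in some nonempty Zariski open subset of $[R]_1 \cong K^4$), the algebra $A/\ell A$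 is Artinian and has the weak Lefschetz property. (iii) The algebra $A/wA$ is Artinian, and it has the weak Lefschetz property if and only if $t$ is odd and $\operatorname{char} K \ne 2$. -/

import Mathlib

open MvPolynomial
open scoped LinearAlgebra.Projectivization

noncomputable section

namespace LevelLefschetz

variable {K : Type*} [Field K] {σ : Type*}

/-- The degree `d` component `[R/J]_d` of the quotient `R/J` of the standard graded polynomial
ring `R = K[X_i : i ∈ σ]` by a (homogeneous) ideal `J`: the classes of the forms of degree `d`. -/
def gradedPiece (J : Ideal (MvPolynomial σ K)) (d : ℕ) : Submodule K (MvPolynomial σ K ⧸ J) :=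
  (homogeneousSubmodule σ K d).map (Ideal.Quotient.mkₐ K J).toLinearMap

/-- `R/J` has the weak Lefschetz property: there is a linear form `ℓ` in `R/J` such that, for
every `d`, multiplication by `ℓ` from `[R/J]_d` to `[R/J]_{d+1}` is injective or surjective.
(In negative degrees there is no condition, because the source is zero.) -/
def HasWLP (J : Ideal (MvPolynomial σ K)) : Prop :=
  ∃ ℓ ∈ gradedPiece J 1, ∀ d : ℕ,
    Set.InjOn (fun a => ℓ * a) (gradedPiece J d : Set (MvPolynomial σ K ⧸ J)) ∨
    Set.SurjOn (fun a => ℓ * a) (gradedPiece J d : Set (MvPolynomial σ K ⧸ J))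
      (gradedPiece J (d + 1) : Set (MvPolynomial σ K ⧸ J))

/-- The socle of `R/J`: the elements that are annihilated by all the variables. -/
def socle (J : Ideal (MvPolynomial σ K)) : Submodule K (MvPolynomial σ K ⧸ J) :=
  ⨅ i : σ, LinearMap.ker (LinearMap.mulLeft K (Ideal.Quotient.mk J (X i)))

/-- `R/J` is Artinian and level of type `τ`: its socle has dimension `τ` and is concentrated in
one degree. -/
def IsArtinianLevel (J : Ideal (MvPolynomial σ K)) (τ : ℕ) : Prop :=
  IsArtinianRing (MvPolynomial σ K ⧸ J) ∧
    Module.finrank K (socle J) = τ ∧ ∃ d : ℕ, socle J ≤ gradedPiece J d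

/-- The ideal `(I, h)` of `R`, so that `R/(I, h) = A/hA` for `A = R/I`. -/
def hyperplaneSection (I : Ideal (MvPolynomial σ K)) (h : MvPolynomial σ K) :
    Ideal (MvPolynomial σ K) :=
  I ⊔ Ideal.span {h}

/-- The form `f` vanishes at the point `p` of projective space. -/
def VanishesAt (f : MvPolynomial σ K) (p : ℙ K (σ → K)) : Prop :=
  eval p.rep f = 0

/-- For forms, vanishing at a point does not depend on the choice of homogeneous coordinates. -/
theorem vanishesAt_mk_iff {f : MvPolynomial σ K} {n : ℕ} (hf : f.IsHomogeneous n)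
    (v : σ → K) (hv : v ≠ 0) :
    VanishesAt f (Projectivization.mk K v hv) ↔ eval v f = 0 := by
  obtain ⟨a, ha⟩ := Projectivization.exists_smul_eq_mk_rep K v hv
  have key : eval (a • v) f = (a : K) ^ n * eval v f := by
    rw [eval_eq, eval_eq, Finset.mul_sum]
    refine Finset.sum_congr rfl fun d hd => ?_
    have hdeg : ∑ i ∈ d.support, d i = n := by
      have h := hf (mem_support_iff.mp hd)
      simpa [Finsupp.weight_apply, Finsupp.sum] using h
    simp only [Units.smul_def, Pi.smul_apply, smul_eq_mul, mul_pow, Finset.prod_mul_distrib,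
      Finset.prod_pow_eq_pow_sum, hdeg]
    ring
  rw [VanishesAt, ← ha, key]
  simp

/-- The set of points of projective space where all the forms in the ideal `I` vanish. -/
def projZeroLocus (I : Ideal (MvPolynomial σ K)) : Set (ℙ K (σ → K)) :=
  {p | ∀ f ∈ I, ∀ n : ℕ, f.IsHomogeneous n → VanishesAt f p}

/-- The homogeneous ideal of a set of points: the ideal generated by all the forms that vanish at
every point of the set. -/
def projVanishingIdeal (Z : Set (ℙ K (σ → K))) : Ideal (MvPolynomial σ K) :=
  Ideal.span {f | (∃ n : ℕ, f.IsHomogeneous n) ∧ ∀ p ∈ Z, VanishesAt f p}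

/-- A finite set `Z` of points is level of type `τ`: with `B = R/I_Z` its homogeneous coordinate
ring, there is a linear form that is a non-zero-divisor on `B`, and for every such linear form `h`
the Artinian reduction `B/hB` is level of type `τ`. -/
def IsLevelPointSet (Z : Set (ℙ K (σ → K))) (τ : ℕ) : Prop :=
  Z.Finite ∧
  (∃ h : MvPolynomial σ K, h.IsHomogeneous 1 ∧
    Ideal.Quotient.mk (projVanishingIdeal Z) h ∈
      nonZeroDivisors (MvPolynomial σ K ⧸ projVanishingIdeal Z)) ∧
  ∀ h : MvPolynomial σ K, h.IsHomogeneous 1 →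
    Ideal.Quotient.mk (projVanishingIdeal Z) h ∈
      nonZeroDivisors (MvPolynomial σ K ⧸ projVanishingIdeal Z) →
    IsArtinianLevel (hyperplaneSection (projVanishingIdeal Z) h) τ

/-- The linear form `∑ i, c i X_i` with coefficient vector `c`. -/
def linearForm [Fintype σ] (c : σ → K) : MvPolynomial σ K :=
  ∑ i, C (c i) * X i

/-- A property holds for a general linear form: it holds for all linear forms whose coefficient
vector lies in some nonempty Zariski open subset of affine space. -/
def ForGeneralLinearForm [Fintype σ] (P : MvPolynomial σ K → Prop) : Prop :=
  ∃ E : Ideal (MvPolynomial σ K), ((zeroLocus K E)ᶜ : Set (σ → K)).Nonempty ∧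
    ∀ c ∈ ((zeroLocus K E)ᶜ : Set (σ → K)), P (linearForm c)

/-- The ideal generated by `∏ (x - iw)`, `∏ (y - iw)`, `∏ (z - iw)` (products over `0 ≤ i ≤ t`)
and `xyz` in `K[w, x, y, z]`, with `w = X 0`, `x = X 1`, `y = X 2`, `z = X 3`. -/
def liftIdeal (K : Type*) [Field K] (t : ℕ) : Ideal (MvPolynomial (Fin 4) K) :=
  Ideal.span {
    ∏ i ∈ Finset.range (t + 1), (X 1 - C (i : K) * X 0),
    ∏ i ∈ Finset.range (t + 1), (X 2 - C (i : K) * X 0),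
    ∏ i ∈ Finset.range (t + 1), (X 3 - C (i : K) * X 0),
    X 1 * X 2 * X 3 }

end LevelLefschetz

end

open LevelLefschetz

/-! The zeros of `liftIdeal K t` are the points `(1 : i : j : k)` of a `(t+1)`-cube grid with `ijk =
0`.

For (i), `cutsOut_liftIdeal` shows that everything vanishing on these points lies in the ideal: the
three faces are complete intersections, glued by residuation (`CutsOut.union`). The count is
`(t+1)^3 - t^3`. A linear form is a non-zero-divisor exactly when it misses all the points. For
levelness, each form in `socleForm` vanishes at every point except one corner, so each linear form
acts on it as a multiple of `w`. The socle of any reduction by a non-zero-divisor `h` can therefore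
be compared with that of the reduction by `w`. There the ideal is monomial, and the socle is spanned
by `(yz)^t`, `(xz)^t`, `(xy)^t`.

For (ii) and the positive half of (iii), `hasWLP_hyperplaneSection` reduces the weak Lefschetz
property to one determinant. Below degree `t + 1` the ideal of the section is just `(xyz, ℓ)`, on
which a suitable `L` is regular, so multiplication is injective from degrees `d < t`. The line `ℓ =
L = 0` meets the planes `x = 0`, `y = 0`, `z = 0` in three points. If the values of the three
product generators there form an invertible matrix, then `R/(I, ℓ, L)` is zero from degree `t + 1`
on, so multiplication is surjective for `d ≥ t`. The matrix has zero diagonal, so its determinant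
has only two terms. For `ℓ = w`, `L = x + y + z` it is `1 + (-1)^(t+1)`; for general `ℓ` it is a
nonzero polynomial in the coefficients.

For the negative half of (iii), suppose `(-1)^t = 1` in `K`. Then for every `L` an explicit kernel
element in degree `t` rules out injectivity, and a functional on degree `t + 1`, or a coefficient
comparison when `L` has a zero coefficient, rules out surjectivity. -/

noncomputable section

namespace LevelLefschetz

/-! ### Ideal membership tested by vanishing on cones. -/

section Cones

variable {K : Type*} [Field K] {σ : Type*}

theorem eval_smul_of_isHomogeneous {f : MvPolynomial σ K} {n : ℕ} (hf : f.IsHomogeneous n)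
    (a : K) (v : σ → K) : eval (a • v) f = a ^ n * eval v f := by
  rw [eval_eq, eval_eq, Finset.mul_sum]
  refine Finset.sum_congr rfl fun d hd => ?_
  have hdeg : ∑ i ∈ d.support, d i = n := by
    have h := hf (mem_support_iff.mp hd)
    simpa [Finsupp.weight_apply, Finsupp.sum] using h
  simp only [Pi.smul_apply, smul_eq_mul, mul_pow, Finset.prod_mul_distrib,
    Finset.prod_pow_eq_pow_sum, hdeg]
  ring

/-- `g` vanishes at all nonzero multiples of `p`. -/
def VanishesOnCone (g : MvPolynomial σ K) (p : σ → K) : Prop :=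
  ∀ a : K, a ≠ 0 → eval (a • p) g = 0

theorem VanishesOnCone.of_isHomogeneous {g : MvPolynomial σ K} {n : ℕ} (hg : g.IsHomogeneous n)
    {p : σ → K} (h : eval p g = 0) : VanishesOnCone g p := fun a _ => by
  rw [eval_smul_of_isHomogeneous hg, h, mul_zero]

theorem eval_smul_ne_zero {g : MvPolynomial σ K} {n : ℕ} (hg : g.IsHomogeneous n)
    {p : σ → K} (h : eval p g ≠ 0) {a : K} (ha : a ≠ 0) : eval (a • p) g ≠ 0 := by
  rw [eval_smul_of_isHomogeneous hg]
  exact mul_ne_zero (pow_ne_zero _ ha) h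

theorem vanishesOnCone_of_mem_span {S : Set (MvPolynomial σ K)} {p : σ → K}
    (hS : ∀ g ∈ S, VanishesOnCone g p) {u : MvPolynomial σ K} (hu : u ∈ Ideal.span S) :
    VanishesOnCone u p := fun a ha => by
  have : Ideal.span S ≤ RingHom.ker (eval (a • p)) :=
    Ideal.span_le.2 fun g hg => hS g hg a ha
  exact this hu

theorem sub_aeval_mem {J : Ideal (MvPolynomial σ K)} (q : σ → MvPolynomial σ K)
    (h : ∀ i, X i - q i ∈ J) (f : MvPolynomial σ K) : f - aeval q f ∈ J := by
  rw [← Ideal.Quotient.eq]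
  have : (Ideal.Quotient.mkₐ K J) = (Ideal.Quotient.mkₐ K J).comp (aeval q) := by
    apply MvPolynomial.algHom_ext
    intro i
    simpa using Ideal.Quotient.eq.2 (h i)
  exact DFunLike.congr_fun this f

/-- Modulo `J` every variable is a multiple of `X j`, so `g` reduces to a polynomial in `X j` alone,
namely its restriction to the line through `p`. Cones replace homogeneity, so that inhomogeneous
cofactors can be tested too. -/
theorem mem_of_vanishesOnCone [Infinite K] {J : Ideal (MvPolynomial σ K)} {p : σ → K} {j : σ}
    (hj : p j ≠ 0) (hJ : ∀ i, C (p j) * X i - C (p i) * X j ∈ J) {g : MvPolynomial σ K}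
    (hg : VanishesOnCone g p) : g ∈ J := by
  have h1 := sub_aeval_mem (J := J) (fun i => C (p i / p j) * X j) (fun i => by
    have := J.mul_mem_left (C (p j)⁻¹) (hJ i)
    convert this using 1
    rw [mul_sub, ← mul_assoc, ← mul_assoc, ← C_mul, ← C_mul, inv_mul_cancel₀ hj, C_1, one_mul,
      div_eq_inv_mul]) g
  -- The restriction is only known to vanish where `c j ≠ 0`; the factor `X j` covers the remaining
  -- hyperplane.
  have h2 : X j * aeval (fun i => C (p i / p j) * X j : σ → MvPolynomial σ K) g = 0 := by
    apply MvPolynomial.funext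
    intro c
    rw [map_mul, eval_X, map_zero]
    by_cases hc : c j = 0
    · rw [hc, zero_mul]
    · have h3 : eval c (aeval (fun i => C (p i / p j) * X j : σ → MvPolynomial σ K) g)
          = eval ((c j / p j) • p) g := by
        rw [← MvPolynomial.coe_aeval_eq_eval, ← MvPolynomial.coe_aeval_eq_eval]
        change ((aeval c).comp (aeval _)) g = aeval _ g
        congr 1
        apply MvPolynomial.algHom_ext
        intro i
        simp
        ring
      rw [h3, hg _ (div_ne_zero hc hj), mul_zero]
  rw [(mul_eq_zero.1 h2).resolve_left (X_ne_zero j), sub_zero] at h1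
  exact h1

/-- Every polynomial that vanishes on the cone over `Z` lies in `J`. -/
def CutsOut (J : Ideal (MvPolynomial σ K)) (Z : Set (σ → K)) : Prop :=
  ∀ f, (∀ p ∈ Z, VanishesOnCone f p) → f ∈ J

theorem CutsOut.mono {J J' : Ideal (MvPolynomial σ K)} {Z Z' : Set (σ → K)} (h : CutsOut J Z)
    (hJ : J ≤ J') (hZ : Z ⊆ Z') : CutsOut J' Z' :=
  fun f hf => hJ (h f fun p hp => hf p (hZ hp))

/-- Residuation: write `f = g * a + u` with `u ∈ J`. On `Z₂` both `f` and `u` vanish while `a` does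
not, so `g` vanishes there and lies in `J₂`. -/
theorem CutsOut.union {a : MvPolynomial σ K} {n : ℕ} (han : a.IsHomogeneous n)
    {J J₂ J' : Ideal (MvPolynomial σ K)} {Z₁ Z₂ : Set (σ → K)}
    (h₁ : CutsOut (Ideal.span {a} ⊔ J) Z₁) (h₂ : CutsOut J₂ Z₂)
    (hJ : ∀ q ∈ Z₂, ∀ u ∈ J, VanishesOnCone u q) (ha : ∀ q ∈ Z₂, eval q a ≠ 0)
    (hJ₂ : ∀ g ∈ J₂, g * a ∈ J') (hJJ' : J ≤ J') : CutsOut J' (Z₁ ∪ Z₂) := by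
  intro f hf
  obtain ⟨g, u, hu, rfl⟩ := Ideal.mem_span_singleton_sup.1 (h₁ f fun p hp => hf p (Or.inl hp))
  refine J'.add_mem (hJ₂ g (h₂ g fun q hq c hc => ?_)) (hJJ' hu)
  have := hf q (Or.inr hq) c hc
  rw [map_add, hJ q hq u hu c hc, add_zero, map_mul] at this
  exact (mul_eq_zero.1 this).resolve_right (eval_smul_ne_zero han (ha q hq) hc)

theorem cutsOut_singleton [Infinite K] {J : Ideal (MvPolynomial σ K)} {p : σ → K} {j : σ}
    (hj : p j ≠ 0) (hJ : ∀ i, C (p j) * X i - C (p i) * X j ∈ J) : CutsOut J {p} :=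
  fun _ hf => mem_of_vanishesOnCone hj hJ (hf p rfl)

end Cones

/-! ### Homogeneous components, and the weak Lefschetz property in terms of forms. -/

section Graded

variable {K : Type*} [Field K] {σ : Type*}

attribute [local instance] MvPolynomial.gradedAlgebra

theorem isHomogeneous_span_forms {S : Set (MvPolynomial σ K)}
    (hS : ∀ f ∈ S, ∃ n, f.IsHomogeneous n) :
    (Ideal.span S).IsHomogeneous (homogeneousSubmodule σ K) :=
  Ideal.homogeneous_span _ _ fun f hf => hS f hf

theorem homogeneousComponent_mem_span {S : Set (MvPolynomial σ K)}
    (hS : ∀ f ∈ S, ∃ n, f.IsHomogeneous n) {f : MvPolynomial σ K} (hf : f ∈ Ideal.span S)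
    (n : ℕ) : homogeneousComponent n f ∈ Ideal.span S :=
  homogeneousComponent_mem_of_mem (isHomogeneous_span_forms hS) hf n

theorem homogeneousComponent_mul_of_lt {f : MvPolynomial σ K} {m n : ℕ} (hf : f.IsHomogeneous m)
    (h : n < m) (g : MvPolynomial σ K) : homogeneousComponent n (f * g) = 0 := by
  rw [← decomposition.decompose'_apply]
  exact DirectSum.coe_decompose_mul_of_left_mem_of_not_le (homogeneousSubmodule σ K) hf
    (not_le.2 h)

theorem homogeneousComponent_mul_add {f : MvPolynomial σ K} {m : ℕ} (hf : f.IsHomogeneous m)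
    (n : ℕ) (g : MvPolynomial σ K) :
    homogeneousComponent (m + n) (f * g) = f * homogeneousComponent n g := by
  rw [← decomposition.decompose'_apply, ← decomposition.decompose'_apply]
  exact DirectSum.coe_decompose_mul_add_of_left_mem (homogeneousSubmodule σ K) hf

theorem mem_gradedPiece {J : Ideal (MvPolynomial σ K)} {d : ℕ} {a : MvPolynomial σ K ⧸ J} :
    a ∈ gradedPiece J d ↔ ∃ f : MvPolynomial σ K, f.IsHomogeneous d ∧ Ideal.Quotient.mk J f = a :=
  Iff.rfl

theorem injOn_gradedPiece_iff {J : Ideal (MvPolynomial σ K)} {d : ℕ} {L : MvPolynomial σ K} :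
    Set.InjOn (fun a => Ideal.Quotient.mk J L * a)
      (gradedPiece J d : Set (MvPolynomial σ K ⧸ J)) ↔
    ∀ f : MvPolynomial σ K, f.IsHomogeneous d → L * f ∈ J → f ∈ J := by
  constructor
  · intro h f hf hLf
    rw [← Ideal.Quotient.eq_zero_iff_mem]
    refine h (mem_gradedPiece.2 ⟨f, hf, rfl⟩) (gradedPiece J d).zero_mem ?_
    simp only [mul_zero, ← map_mul]
    exact Ideal.Quotient.eq_zero_iff_mem.2 hLf
  · rintro h a ha b hb hab
    obtain ⟨f, hf, rfl⟩ := mem_gradedPiece.1 ha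
    obtain ⟨g, hg, rfl⟩ := mem_gradedPiece.1 hb
    refine Ideal.Quotient.eq.2 (h _ (hf.sub hg) ?_)
    simp only [← map_mul] at hab
    rw [mul_sub]
    exact Ideal.Quotient.eq.1 hab

theorem surjOn_gradedPiece_iff {J : Ideal (MvPolynomial σ K)} {d : ℕ} {L : MvPolynomial σ K} :
    Set.SurjOn (fun a => Ideal.Quotient.mk J L * a)
      (gradedPiece J d : Set (MvPolynomial σ K ⧸ J))
      (gradedPiece J (d + 1) : Set (MvPolynomial σ K ⧸ J)) ↔
    ∀ f : MvPolynomial σ K, f.IsHomogeneous (d + 1) →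
      ∃ g : MvPolynomial σ K, g.IsHomogeneous d ∧ f - L * g ∈ J := by
  constructor
  · intro h f hf
    obtain ⟨_, hb, hab⟩ := h (mem_gradedPiece.2 ⟨f, hf, rfl⟩)
    obtain ⟨g, hg, rfl⟩ := mem_gradedPiece.1 hb
    refine ⟨g, hg, Ideal.Quotient.eq.1 ?_⟩
    rw [map_mul]
    exact hab.symm
  · rintro h a ha
    obtain ⟨f, hf, rfl⟩ := mem_gradedPiece.1 ha
    obtain ⟨g, hg, hfg⟩ := h f hf
    refine ⟨_, mem_gradedPiece.2 ⟨g, hg, rfl⟩, ?_⟩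
    simp only [← map_mul]
    exact (Ideal.Quotient.eq.2 hfg).symm

theorem hasWLP_iff {J : Ideal (MvPolynomial σ K)} :
    HasWLP J ↔ ∃ L : MvPolynomial σ K, L.IsHomogeneous 1 ∧ ∀ d : ℕ,
      (∀ f : MvPolynomial σ K, f.IsHomogeneous d → L * f ∈ J → f ∈ J) ∨
      (∀ f : MvPolynomial σ K, f.IsHomogeneous (d + 1) →
        ∃ g : MvPolynomial σ K, g.IsHomogeneous d ∧ f - L * g ∈ J) := by
  constructor
  · rintro ⟨_, hl, h⟩
    obtain ⟨L, hL, rfl⟩ := mem_gradedPiece.1 hl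
    refine ⟨L, hL, fun d => ?_⟩
    rw [← injOn_gradedPiece_iff, ← surjOn_gradedPiece_iff]
    exact h d
  · rintro ⟨L, hL, h⟩
    refine ⟨_, mem_gradedPiece.2 ⟨L, hL, rfl⟩, fun d => ?_⟩
    rw [injOn_gradedPiece_iff, surjOn_gradedPiece_iff]
    exact h d

/-- Every monomial of degree `n + 1` is a variable times a monomial of degree `n`. -/
theorem mem_of_forms_mem {J : Ideal (MvPolynomial σ K)} {d : ℕ}
    (h : ∀ f : MvPolynomial σ K, f.IsHomogeneous d → f ∈ J) {n : ℕ} (hn : d ≤ n)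
    {f : MvPolynomial σ K} (hf : f.IsHomogeneous n) : f ∈ J := by
  have key : ∀ n, d ≤ n → ∀ m : σ →₀ ℕ, m.degree = n → monomial m (1 : K) ∈ J := by
    intro n hn
    induction n, hn using Nat.le_induction with
    | base => exact fun m hm => h _ (isHomogeneous_monomial _ hm)
    | succ n hn ih =>
      intro m hm
      have hm0 : m ≠ 0 := by
        rintro rfl
        simp at hm
      obtain ⟨i, hi⟩ := Finsupp.ne_iff.1 hm0
      have hle : Finsupp.single i 1 ≤ m := by
        rw [Finsupp.single_le_iff]
        exact Nat.one_le_iff_ne_zero.2 hi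
      have hadd : m = Finsupp.single i 1 + (m - Finsupp.single i 1) :=
        (add_tsub_cancel_of_le hle).symm
      have hdeg : (m - Finsupp.single i 1).degree = n := by
        have := congrArg Finsupp.degree hadd
        rw [map_add, hm, Finsupp.degree_single] at this
        omega
      have : monomial m (1 : K) = monomial (m - Finsupp.single i 1) 1 * X i := by
        rw [X, monomial_mul, one_mul, add_comm, ← hadd]
      rw [this]
      exact J.mul_mem_right _ (ih _ hdeg)
  rw [f.as_sum]
  refine J.sum_mem fun m hm => ?_
  have := J.mul_mem_left (C (coeff m f)) (key n hn m (by
    by_contra hne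
    exact (mem_support_iff.1 hm) (hf.coeff_eq_zero hne)))
  rwa [C_mul_monomial, mul_one] at this

end Graded

/-! ### Grids of points and the ideal of the grid boundary. -/

variable {K : Type*} [Field K]

/-- The product of the linear forms `X i - n X 0` for `n ∈ A`. -/
def gridProd (K : Type*) [Field K] (A : Finset ℕ) (i : Fin 4) : MvPolynomial (Fin 4) K :=
  ∏ n ∈ A, (X i - C (n : K) * X 0)

theorem isHomogeneous_X_sub (i : Fin 4) (a : K) :
    (X i - C a * X 0 : MvPolynomial (Fin 4) K).IsHomogeneous 1 :=
  (isHomogeneous_X K i).sub (isHomogeneous_C_mul_X a 0)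

theorem isHomogeneous_gridProd (A : Finset ℕ) (i : Fin 4) :
    (gridProd K A i).IsHomogeneous A.card := by
  have := IsHomogeneous.prod A (fun n : ℕ => (X i - C (n : K) * X 0 : MvPolynomial (Fin 4) K))
    (fun _ => 1) fun n _ => isHomogeneous_X_sub i (n : K)
  simpa [gridProd] using this

theorem eval_gridProd (A : Finset ℕ) (i : Fin 4) (q : Fin 4 → K) :
    eval q (gridProd K A i) = ∏ n ∈ A, (q i - n * q 0) := by
  simp [gridProd, map_prod]

theorem gridProd_singleton_zero (i : Fin 4) : gridProd K {0} i = X i := by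
  simp [gridProd]

theorem gridProd_range_succ_eq (t : ℕ) (i : Fin 4) :
    gridProd K (Finset.range (t + 1)) i = X i * gridProd K ((Finset.range (t + 1)).erase 0) i := by
  rw [gridProd, ← Finset.mul_prod_erase _ _ (Finset.mem_range.2 t.succ_pos)]
  simp [gridProd]

theorem liftIdeal_eq (t : ℕ) : liftIdeal K t =
    Ideal.span {X 1 * X 2 * X 3} ⊔ (Ideal.span {gridProd K (Finset.range (t + 1)) 1} ⊔
      Ideal.span {gridProd K (Finset.range (t + 1)) 2} ⊔
      Ideal.span {gridProd K (Finset.range (t + 1)) 3}) := by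
  simp only [← Ideal.span_union, liftIdeal, gridProd]
  congr 1
  ext f
  simp only [Set.mem_insert_iff, Set.mem_singleton_iff, Set.mem_union]
  tauto

theorem vanishesOnCone_of_mem_sup {σ : Type*} {J₁ J₂ : Ideal (MvPolynomial σ K)} {p : σ → K}
    (h₁ : ∀ u ∈ J₁, VanishesOnCone u p) (h₂ : ∀ u ∈ J₂, VanishesOnCone u p) :
    ∀ u ∈ J₁ ⊔ J₂, VanishesOnCone u p := by
  intro u hu a ha
  obtain ⟨v, hv, w, hw, rfl⟩ := Submodule.mem_sup.1 hu
  rw [map_add, h₁ v hv a ha, h₂ w hw a ha, add_zero]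

theorem vanishesOnCone_of_mem_span_singleton {σ : Type*} {g : MvPolynomial σ K} {n : ℕ}
    (hg : g.IsHomogeneous n) {p : σ → K} (h : eval p g = 0) :
    ∀ u ∈ Ideal.span {g}, VanishesOnCone u p := fun _ hu =>
  vanishesOnCone_of_mem_span (by
    rintro _ rfl
    exact .of_isHomogeneous hg h) hu

/-- The affine representative `(1, i, j, k)` of a grid point. -/
def gridPoint (K : Type*) [Field K] (i j k : ℕ) : Fin 4 → K := ![1, i, j, k]

@[simp] theorem gridPoint_zero (i j k : ℕ) : gridPoint K i j k 0 = 1 := rfl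
@[simp] theorem gridPoint_one (i j k : ℕ) : gridPoint K i j k 1 = i := rfl
@[simp] theorem gridPoint_two (i j k : ℕ) : gridPoint K i j k 2 = j := rfl
@[simp] theorem gridPoint_three (i j k : ℕ) : gridPoint K i j k 3 = k := rfl

/-- The grid points with coordinates in the given finite sets. -/
def grid (K : Type*) [Field K] (A B D : Finset ℕ) : Set (Fin 4 → K) :=
  {p | ∃ i ∈ A, ∃ j ∈ B, ∃ k ∈ D, p = gridPoint K i j k}

/-- The planes `X i = n X 0` are added one at a time by `CutsOut.union`; the product over the
earlier planes plays the role of `a`, nonzero on the new slice because the casts are distinct. -/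
theorem cutsOut_gridProd {A : Finset ℕ} (hA : Set.InjOn (Nat.cast : ℕ → K) A) (i : Fin 4)
    {J : Ideal (MvPolynomial (Fin 4) K)} {Z : ℕ → Set (Fin 4 → K)}
    (h : ∀ n ∈ A, CutsOut (Ideal.span {X i - C (n : K) * X 0} ⊔ J) (Z n))
    (hJ : ∀ n ∈ A, ∀ q ∈ Z n, ∀ u ∈ J, VanishesOnCone u q)
    (hZ : ∀ n ∈ A, ∀ q ∈ Z n, q 0 = 1 ∧ q i = n) :
    CutsOut (Ideal.span {gridProd K A i} ⊔ J) {q | ∃ n ∈ A, q ∈ Z n} := by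
  classical
  induction A using Finset.induction_on with
  | empty =>
    intro f _
    rw [gridProd, Finset.prod_empty, Ideal.span_singleton_one, top_sup_eq]
    trivial
  | insert n A hn ih =>
    have ih' := ih (hA.mono (by simp)) (fun m hm => h m (by simp [hm]))
      (fun m hm => hJ m (by simp [hm])) (fun m hm => hZ m (by simp [hm]))
    refine (CutsOut.union (J' := Ideal.span {gridProd K (insert n A) i} ⊔ J)
      (isHomogeneous_gridProd A i) ih' (h n (by simp)) (hJ n (by simp)) ?_ ?_ le_sup_right).mono
      le_rfl ?_
    · intro q hq
      rw [eval_gridProd, Finset.prod_ne_zero_iff]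
      intro m hm
      obtain ⟨h0, hi⟩ := hZ n (by simp) q hq
      rw [h0, hi, mul_one, sub_ne_zero]
      intro he
      have := hA (by simp) (by simp [hm]) he
      exact hn (this ▸ hm)
    · intro g hg
      obtain ⟨r, u, hu, rfl⟩ := Ideal.mem_span_singleton_sup.1 hg
      refine Ideal.mem_span_singleton_sup.2 ⟨r, u * gridProd K A i, J.mul_mem_right _ hu, ?_⟩
      rw [gridProd, Finset.prod_insert hn, gridProd]
      ring
    · rintro q (⟨m, hm, hq⟩ | hq)
      · exact ⟨m, by simp [hm], hq⟩
      · exact ⟨n, by simp, hq⟩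

theorem cutsOut_gridPoint [Infinite K] (i j k : ℕ) :
    CutsOut (Ideal.span {X 3 - C (k : K) * X 0} ⊔ (Ideal.span {X 1 - C (i : K) * X 0} ⊔
      Ideal.span {X 2 - C (j : K) * X 0})) {gridPoint K i j k} := by
  refine cutsOut_singleton (j := 0) (by simp) fun m => ?_
  fin_cases m
  · simp
  · refine Ideal.mem_sup_right (Ideal.mem_sup_left ?_)
    simp
  · refine Ideal.mem_sup_right (Ideal.mem_sup_right ?_)
    simp
  · refine Ideal.mem_sup_left ?_
    simp

theorem cutsOut_grid [Infinite K] {A B D : Finset ℕ} (hA : Set.InjOn (Nat.cast : ℕ → K) A)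
    (hB : Set.InjOn (Nat.cast : ℕ → K) B) (hD : Set.InjOn (Nat.cast : ℕ → K) D) :
    CutsOut (Ideal.span {gridProd K A 1} ⊔ (Ideal.span {gridProd K B 2} ⊔
      Ideal.span {gridProd K D 3})) (grid K A B D) := by
  have h3 : ∀ i j : ℕ, CutsOut (Ideal.span {X 2 - C (j : K) * X 0} ⊔
      (Ideal.span {X 1 - C (i : K) * X 0} ⊔ Ideal.span {gridProd K D 3}))
      {q | ∃ k ∈ D, q = gridPoint K i j k} := fun i j => by
    refine (cutsOut_gridProd hD 3 (J := Ideal.span {X 1 - C (i : K) * X 0} ⊔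
      Ideal.span {X 2 - C (j : K) * X 0}) (Z := fun k => {gridPoint K i j k})
      (fun k _ => cutsOut_gridPoint i j k) ?_ ?_).mono (le_of_eq (by ac_rfl)) subset_rfl
    · rintro k hk q rfl
      exact vanishesOnCone_of_mem_sup
        (vanishesOnCone_of_mem_span_singleton (isHomogeneous_X_sub _ _) (by simp))
        (vanishesOnCone_of_mem_span_singleton (isHomogeneous_X_sub _ _) (by simp))
    · rintro k hk q rfl
      simp
  have h2 : ∀ i : ℕ, CutsOut (Ideal.span {X 1 - C (i : K) * X 0} ⊔
      (Ideal.span {gridProd K B 2} ⊔ Ideal.span {gridProd K D 3}))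
      {q | ∃ j ∈ B, ∃ k ∈ D, q = gridPoint K i j k} := fun i => by
    refine (cutsOut_gridProd hB 2 (fun j _ => h3 i j) ?_ ?_).mono (le_of_eq (by ac_rfl)) subset_rfl
    · rintro j hj q ⟨k, hk, rfl⟩
      exact vanishesOnCone_of_mem_sup
        (vanishesOnCone_of_mem_span_singleton (isHomogeneous_X_sub _ _) (by simp))
        (vanishesOnCone_of_mem_span_singleton (isHomogeneous_gridProd _ _) (by
          rw [eval_gridProd]
          exact Finset.prod_eq_zero hk (by simp)))
    · rintro j hj q ⟨k, hk, rfl⟩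
      simp
  refine cutsOut_gridProd hA 1 (fun i _ => h2 i) ?_ ?_
  · rintro i hi q ⟨j, hj, k, hk, rfl⟩
    exact vanishesOnCone_of_mem_sup
      (vanishesOnCone_of_mem_span_singleton (isHomogeneous_gridProd _ _) (by
        rw [eval_gridProd]
        exact Finset.prod_eq_zero hj (by simp)))
      (vanishesOnCone_of_mem_span_singleton (isHomogeneous_gridProd _ _) (by
        rw [eval_gridProd]
        exact Finset.prod_eq_zero hk (by simp)))
  · rintro i hi q ⟨j, hj, k, hk, rfl⟩
    simp

/-- The affine representatives of the points of the zero set of `liftIdeal K t`. -/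
def gridBoundary (K : Type*) [Field K] (t : ℕ) : Set (Fin 4 → K) :=
  {p | ∃ i j k : ℕ, i ≤ t ∧ j ≤ t ∧ k ≤ t ∧ i * j * k = 0 ∧ p = gridPoint K i j k}

/-- The boundary splits into three disjoint grids: `x = 0`; then `y = 0` with `x ≠ 0`; then `z = 0`
with `xy ≠ 0`. Each is a complete intersection, and they are glued by residuation with respect to
`x` and then `xy`. -/
theorem cutsOut_liftIdeal [Infinite K] {t : ℕ}
    (hinj : Set.InjOn (Nat.cast : ℕ → K) (Finset.range (t + 1))) :
    CutsOut (liftIdeal K t) (gridBoundary K t) := by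
  rw [liftIdeal_eq]
  set A := Finset.range (t + 1) with hA
  set B := A.erase 0 with hB
  have hBA : B ⊆ A := Finset.erase_subset _ _
  have hinjB : Set.InjOn (Nat.cast : ℕ → K) B := hinj.mono (by exact_mod_cast hBA)
  have hinj0 : Set.InjOn (Nat.cast : ℕ → K) (({0} : Finset ℕ) : Set ℕ) := by simp
  have h0A : 0 ∈ A := by simp [hA]
  have hne : ∀ n ∈ B, (n : K) ≠ 0 := fun n hn h => by
    have := hinj (hBA hn) h0A (by simpa using h)
    simp [hB, this] at hn
  have hfac : ∀ i, gridProd K A i = X i * gridProd K B i := gridProd_range_succ_eq t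
  set J := Ideal.span {gridProd K A 1} ⊔ Ideal.span {gridProd K A 2} ⊔
    Ideal.span {gridProd K A 3} with hJ
  have hJvan : ∀ B' ⊆ A, ∀ C' ⊆ A, ∀ D' ⊆ A, ∀ q ∈ grid K B' C' D', ∀ u ∈ J,
      VanishesOnCone u q := by
    rintro B' hB' C' hC' D' hD' q ⟨i, hi, j, hj, k, hk, rfl⟩
    refine vanishesOnCone_of_mem_sup (vanishesOnCone_of_mem_sup ?_ ?_) ?_
    · refine vanishesOnCone_of_mem_span_singleton (isHomogeneous_gridProd _ _) ?_
      rw [eval_gridProd]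
      exact Finset.prod_eq_zero (hB' hi) (by simp)
    · refine vanishesOnCone_of_mem_span_singleton (isHomogeneous_gridProd _ _) ?_
      rw [eval_gridProd]
      exact Finset.prod_eq_zero (hC' hj) (by simp)
    · refine vanishesOnCone_of_mem_span_singleton (isHomogeneous_gridProd _ _) ?_
      rw [eval_gridProd]
      exact Finset.prod_eq_zero (hD' hk) (by simp)
  have hJ1 : gridProd K A 1 ∈ J :=
    Ideal.mem_sup_left (Ideal.mem_sup_left (Ideal.mem_span_singleton_self _))
  have hJ2 : gridProd K A 2 ∈ J :=
    Ideal.mem_sup_left (Ideal.mem_sup_right (Ideal.mem_span_singleton_self _))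
  have hJ3 : gridProd K A 3 ∈ J := Ideal.mem_sup_right (Ideal.mem_span_singleton_self _)
  have h1 : CutsOut (Ideal.span {X 1} ⊔ J) (grid K {0} A A) := by
    refine (cutsOut_grid hinj0 hinj hinj).mono ?_ subset_rfl
    rw [gridProd_singleton_zero]
    refine sup_le le_sup_left (sup_le ?_ ?_) <;>
      rw [Ideal.span_singleton_le_iff_mem] <;> apply Ideal.mem_sup_right <;> assumption
  have h2 : CutsOut (Ideal.span {X 1 * X 2} ⊔ J) (grid K {0} A A ∪ grid K B {0} A) := by
    refine h1.union (isHomogeneous_X _ _) (cutsOut_grid hinjB hinj0 hinj)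
      (hJvan _ hBA _ (by simpa) _ subset_rfl) ?_ ?_ le_sup_right
    · rintro q ⟨i, hi, j, hj, k, hk, rfl⟩
      simpa using hne i hi
    · intro g hg
      rw [gridProd_singleton_zero] at hg
      obtain ⟨r, u, hu, rfl⟩ := Ideal.mem_span_singleton_sup.1 hg
      obtain ⟨r', v, hv, rfl⟩ := Ideal.mem_span_singleton_sup.1 hu
      obtain ⟨r'', rfl⟩ := Ideal.mem_span_singleton'.1 hv
      -- As `B` is `A` without `0`, multiplying by `X 1` restores the missing factor of the full
      -- product.
      have : (r * gridProd K B 1 + (r' * X 2 + r'' * gridProd K A 3)) * X 1 =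
          r' * (X 1 * X 2) + (r * gridProd K A 1 + r'' * X 1 * gridProd K A 3) := by
        rw [hfac 1]; ring
      rw [this]
      exact add_mem (Ideal.mem_sup_left (Ideal.mul_mem_left _ _ (Ideal.mem_span_singleton_self _)))
        (Ideal.mem_sup_right (add_mem (J.mul_mem_left _ hJ1) (J.mul_mem_left _ hJ3)))
  have h3 : CutsOut (Ideal.span {X 1 * X 2 * X 3} ⊔ J)
      (grid K {0} A A ∪ grid K B {0} A ∪ grid K B B {0}) := by
    refine h2.union ((isHomogeneous_X _ _).mul (isHomogeneous_X _ _))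
      (cutsOut_grid hinjB hinjB hinj0) (hJvan _ hBA _ hBA _ (by simpa)) ?_ ?_ le_sup_right
    · rintro q ⟨i, hi, j, hj, k, hk, rfl⟩
      simpa using ⟨hne i hi, hne j hj⟩
    · intro g hg
      rw [gridProd_singleton_zero] at hg
      obtain ⟨r, u, hu, rfl⟩ := Ideal.mem_span_singleton_sup.1 hg
      obtain ⟨r', v, hv, rfl⟩ := Ideal.mem_span_singleton_sup.1 hu
      obtain ⟨r'', rfl⟩ := Ideal.mem_span_singleton'.1 hv
      have : (r * gridProd K B 1 + (r' * gridProd K B 2 + r'' * X 3)) * (X 1 * X 2) =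
          r'' * (X 1 * X 2 * X 3) + (r * X 2 * gridProd K A 1 + r' * X 1 * gridProd K A 2) := by
        rw [hfac 1, hfac 2]; ring
      rw [this]
      exact add_mem (Ideal.mem_sup_left (Ideal.mul_mem_left _ _ (Ideal.mem_span_singleton_self _)))
        (Ideal.mem_sup_right (add_mem (J.mul_mem_left _ hJ1) (J.mul_mem_left _ hJ2)))
  refine h3.mono le_rfl ?_
  rintro q ((⟨i, hi, j, hj, k, hk, rfl⟩ | ⟨i, hi, j, hj, k, hk, rfl⟩) |
    ⟨i, hi, j, hj, k, hk, rfl⟩) <;>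
  simp only [hA, hB, Finset.mem_erase, Finset.mem_range, Finset.mem_singleton] at hi hj hk <;>
  refine ⟨i, j, k, by omega, by omega, by omega, ?_, rfl⟩ <;> simp [*]

/-- Here and below `s : Fin 3` labels `x, y, z` through `s.succ`. -/
theorem gridProd_mem_liftIdeal (t : ℕ) (s : Fin 3) :
    gridProd K (Finset.range (t + 1)) s.succ ∈ liftIdeal K t := by
  fin_cases s <;> exact Ideal.subset_span (by simp [gridProd])

theorem X_mul_X_mul_X_mem_liftIdeal (t : ℕ) :
    (X 1 * X 2 * X 3 : MvPolynomial (Fin 4) K) ∈ liftIdeal K t :=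
  Ideal.subset_span (by simp)

/-! ### Artinian hyperplane sections. -/

theorem isMaximal_of_X_mem {σ : Type*} {P : Ideal (MvPolynomial σ K)} [hP : P.IsPrime]
    (h : ∀ i, X i ∈ P) : P.IsMaximal := by
  have hmem : ∀ f, f - C (constantCoeff f) ∈ P := fun f => by
    have := sub_aeval_mem (J := P) (fun _ => 0) (by simpa using h) f
    rw [aeval_zero'] at this
    simpa using this
  have hker : P = RingHom.ker (constantCoeff : MvPolynomial σ K →+* K) := by
    ext f
    rw [RingHom.mem_ker]
    constructor
    · intro hf
      by_contra hne
      have hC : C (constantCoeff f) ∈ P := by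
        have := P.sub_mem hf (hmem f)
        rwa [sub_sub_cancel] at this
      exact hP.ne_top (P.eq_top_of_isUnit_mem hC ((isUnit_iff_ne_zero.2 hne).map C))
    · intro hf
      have := hmem f
      rwa [hf, C_0, sub_zero] at this
  rw [hker]
  exact RingHom.ker_isMaximal_of_surjective _ fun a => ⟨C a, by simp⟩

/-- A prime over the ideal contains the linear equations of some boundary point. Modulo these, the
linear form is its value at that point times `w`; the value is nonzero, so the prime contains `w`
and hence all the variables. -/
theorem isArtinianRing_hyperplaneSection {t : ℕ} {c : Fin 4 → K}
    (hc : ∀ p ∈ gridBoundary K t, eval p (linearForm c) ≠ 0) :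
    IsArtinianRing (MvPolynomial (Fin 4) K ⧸ hyperplaneSection (liftIdeal K t) (linearForm c)) := by
  rw [isArtinianRing_iff_krullDimLE_zero,
    Ideal.krullDimLE_zero_quotient_iff_forall_minimalPrimes_isMaximal]
  rintro P ⟨⟨hP, hle⟩, -⟩
  have hI : liftIdeal K t ≤ P := le_sup_left.trans hle
  have hl : linearForm c ∈ P := hle (Ideal.mem_sup_right (Ideal.mem_span_singleton_self _))
  have hroot : ∀ s : Fin 3, ∃ n ≤ t, X s.succ - C (n : K) * X 0 ∈ P := fun s => by
    obtain ⟨n, hn, h⟩ := (Ideal.IsPrime.prod_mem_iff).1 (hI (gridProd_mem_liftIdeal t s))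
    exact ⟨n, Nat.lt_succ_iff.1 (Finset.mem_range.1 hn), h⟩
  obtain ⟨i, j, k, hi, hj, hk, hijk, hPi, hPj, hPk⟩ : ∃ i j k : ℕ, i ≤ t ∧ j ≤ t ∧ k ≤ t ∧
      i * j * k = 0 ∧ X 1 - C (i : K) * X 0 ∈ P ∧ X 2 - C (j : K) * X 0 ∈ P ∧
      X 3 - C (k : K) * X 0 ∈ P := by
    obtain ⟨i, hi, hi'⟩ := hroot 0
    obtain ⟨j, hj, hj'⟩ := hroot 1
    obtain ⟨k, hk, hk'⟩ := hroot 2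
    -- Since `xyz ∈ P`, one of the three indices can be replaced by `0`, so the point lies on the
    -- boundary.
    rcases hP.mem_or_mem (hI (X_mul_X_mul_X_mem_liftIdeal t)) with h | h
    · rcases hP.mem_or_mem h with h | h
      · exact ⟨0, j, k, t.zero_le, hj, hk, by simp, by simpa using h, hj', hk'⟩
      · exact ⟨i, 0, k, hi, t.zero_le, hk, by simp, hi', by simpa using h, hk'⟩
    · exact ⟨i, j, 0, hi, hj, t.zero_le, by simp, hi', hj', by simpa using h⟩
  have hne := hc _ ⟨i, j, k, hi, hj, hk, hijk, rfl⟩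
  set κ := eval (gridPoint K i j k) (linearForm c) with hκ
  have hκ' : κ = c 0 + c 1 * i + c 2 * j + c 3 * k := by
    simp [hκ, linearForm, Fin.sum_univ_four]
  have h0 : X 0 ∈ P := by
    have h1 : C κ * X 0 ∈ P := by
      have h2 : C κ * X 0 = linearForm c - C (c 1) * (X 1 - C (i : K) * X 0) -
          C (c 2) * (X 2 - C (j : K) * X 0) - C (c 3) * (X 3 - C (k : K) * X 0) := by
        rw [hκ', linearForm, Fin.sum_univ_four]
        simp only [C_add, C_mul]
        ring
      rw [h2]
      exact sub_mem (sub_mem (sub_mem hl (P.mul_mem_left _ hPi)) (P.mul_mem_left _ hPj))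
        (P.mul_mem_left _ hPk)
    have h2 := P.mul_mem_left (C κ⁻¹) h1
    rwa [← mul_assoc, ← C_mul, inv_mul_cancel₀ hne, C_1, one_mul] at h2
  have hX : ∀ {m : Fin 4} {a : K}, X m - C a * X 0 ∈ P → X m ∈ P := fun {m a} h => by
    have := P.add_mem h (P.mul_mem_left (C a) h0)
    rwa [sub_add_cancel] at this
  refine isMaximal_of_X_mem fun m => ?_
  fin_cases m
  · exact h0
  · exact hX hPi
  · exact hX hPj
  · exact hX hPk

/-! ### A determinantal criterion for the weak Lefschetz property. -/

theorem isHomogeneous_linearForm {σ : Type*} [Fintype σ] (c : σ → K) :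
    (linearForm c).IsHomogeneous 1 :=
  IsHomogeneous.sum _ _ _ fun i _ => isHomogeneous_C_mul_X (c i) i

theorem eval_linearForm {σ : Type*} [Fintype σ] (c p : σ → K) :
    eval p (linearForm c) = ∑ i, c i * p i := by
  simp [linearForm]

/-- `J` is the kernel of the substitution `q`, a map to a domain. In the two applications `q` solves
the linear form for `X 0`, which needs `c 0 ≠ 0`. -/
theorem isPrime_of_retraction {σ : Type*} {J : Ideal (MvPolynomial σ K)}
    (q : σ → MvPolynomial σ K) (h : ∀ i, X i - q i ∈ J)
    (hq : ∀ f ∈ J, aeval q f = 0) : J.IsPrime := by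
  have : J = RingHom.ker (aeval q : MvPolynomial σ K →ₐ[K] MvPolynomial σ K) := by
    ext f
    refine ⟨hq f, fun hf => ?_⟩
    have := sub_aeval_mem q h f
    rwa [show aeval q f = 0 from hf, sub_zero] at this
  rw [this]
  exact RingHom.ker_isPrime _

theorem isPrime_span_linearForm {c : Fin 4 → K} (hc : c 0 ≠ 0) :
    (Ideal.span {linearForm c}).IsPrime := by
  refine isPrime_of_retraction (fun i => if i = 0 then -C (c 0)⁻¹ *
    (C (c 1) * X 1 + C (c 2) * X 2 + C (c 3) * X 3) else X i) (fun i => ?_) fun f hf => ?_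
  · by_cases hi : i = 0
    · subst hi
      rw [if_pos rfl]
      refine Ideal.mem_span_singleton'.2 ⟨C (c 0)⁻¹, ?_⟩
      have h : (C (c 0)⁻¹ * C (c 0) : MvPolynomial (Fin 4) K) = 1 := by
        rw [← C_mul, inv_mul_cancel₀ hc, C_1]
      rw [linearForm, Fin.sum_univ_four]
      linear_combination X 0 * h
    · simp [hi]
  · obtain ⟨r, rfl⟩ := Ideal.mem_span_singleton'.1 hf
    have h : (C (c 0) * C (c 0)⁻¹ : MvPolynomial (Fin 4) K) = 1 := by
      rw [← C_mul, mul_inv_cancel₀ hc, C_1]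
    rw [map_mul, linearForm, Fin.sum_univ_four]
    simp only [map_add, map_mul, aeval_C, aeval_X, algebraMap_eq, Fin.isValue, if_true,
      Fin.reduceEq, if_false]
    linear_combination -(aeval _ r) * (C (c 1) * X 1 + C (c 2) * X 2 + C (c 3) * X 3) * h

theorem sum_eq_add_sum_ite {M : Type*} [AddCommMonoid M] {ι : Type*} [Fintype ι] [DecidableEq ι]
    (s : ι) (g : ι → M) : ∑ j, g j = g s + ∑ j, if j = s then 0 else g j := by
  rw [← Finset.add_sum_erase _ _ (Finset.mem_univ s),
    ← Finset.add_sum_erase (a := s) _ (fun j => if j = s then 0 else g j) (Finset.mem_univ s),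
    if_pos rfl, zero_add]
  congr 1
  exact Finset.sum_congr rfl fun j hj => (if_neg (Finset.ne_of_mem_erase hj)).symm

theorem isPrime_span_X_sup_span_linearForm {c : Fin 4 → K} (hc : c 0 ≠ 0) (s : Fin 3) :
    (Ideal.span {X s.succ} ⊔ Ideal.span {linearForm c}).IsPrime := by
  set q : Fin 4 → MvPolynomial (Fin 4) K := fun i => if i = 0 then -C (c 0)⁻¹ *
    (∑ j : Fin 3, if j = s then 0 else C (c j.succ) * X j.succ) else
      if i = s.succ then 0 else X i with hq
  have hX : X s.succ ∈ Ideal.span {X s.succ} ⊔ Ideal.span {linearForm c} :=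
    Ideal.mem_sup_left (Ideal.mem_span_singleton_self _)
  have hsum : linearForm c = C (c 0) * X 0 + C (c s.succ) * X s.succ +
      ∑ j : Fin 3, if j = s then 0 else C (c j.succ) * X j.succ := by
    rw [linearForm, Fin.sum_univ_succ, add_assoc, sum_eq_add_sum_ite s]
  refine isPrime_of_retraction q (fun i => ?_) fun f hf => ?_
  · by_cases hi : i = 0
    · subst hi
      have h : (C (c 0)⁻¹ * C (c 0) : MvPolynomial (Fin 4) K) = 1 := by
        rw [← C_mul, inv_mul_cancel₀ hc, C_1]
      have h2 : X 0 - q 0 = -(C (c 0)⁻¹ * C (c s.succ)) * X s.succ + C (c 0)⁻¹ * linearForm c := by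
        rw [hsum, hq]
        simp only [if_true]
        linear_combination -X 0 * h
      rw [h2]
      exact add_mem (Ideal.mul_mem_left _ _ hX)
        (Ideal.mem_sup_right (Ideal.mul_mem_left _ _ (Ideal.mem_span_singleton_self _)))
    · by_cases his : i = s.succ
      · subst his
        simpa [hq, Fin.succ_ne_zero] using hX
      · simp [hq, hi, his]
  · have hqs : q s.succ = 0 := by simp [hq, Fin.succ_ne_zero]
    obtain ⟨r, u, hu, rfl⟩ := Ideal.mem_span_singleton_sup.1 hf
    obtain ⟨r', rfl⟩ := Ideal.mem_span_singleton'.1 hu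
    have h : (C (c 0) * C (c 0)⁻¹ : MvPolynomial (Fin 4) K) = 1 := by
      rw [← C_mul, mul_inv_cancel₀ hc, C_1]
    have hl : aeval q (linearForm c) = 0 := by
      have hrest : aeval q (∑ j : Fin 3, if j = s then 0 else C (c j.succ) * X j.succ) =
          ∑ j : Fin 3, if j = s then 0 else C (c j.succ) * X j.succ := by
        rw [map_sum]
        refine Finset.sum_congr rfl fun j _ => ?_
        by_cases hj : j = s
        · simp [hj]
        · simp [hj, hq, Fin.succ_ne_zero, MvPolynomial.algebraMap_eq]
      rw [hsum, map_add, map_add, hrest, map_mul, map_mul, aeval_X, aeval_X, hqs, aeval_C,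
        MvPolynomial.algebraMap_eq]
      have hq0 : q 0 = -C (c 0)⁻¹ *
        (∑ j : Fin 3, if j = s then 0 else C (c j.succ) * X j.succ) := by simp [hq]
      rw [hq0]
      linear_combination -(∑ j : Fin 3, if j = s then 0 else C (c j.succ) * X j.succ :
        MvPolynomial (Fin 4) K) * h
    rw [map_add, map_mul, map_mul, aeval_X, hqs, hl, mul_zero, mul_zero, add_zero]

theorem homogeneousComponent_eq_zero_of_mem_span {σ : Type*} {S : Set (MvPolynomial σ K)} {n : ℕ}
    (hS : ∀ g ∈ S, ∃ m, n < m ∧ g.IsHomogeneous m) {f : MvPolynomial σ K}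
    (hf : f ∈ Ideal.span S) : homogeneousComponent n f = 0 := by
  -- Quantifying over multiples makes the induction pass through the scalar step.
  have key : ∀ a : MvPolynomial σ K, homogeneousComponent n (a * f) = 0 := by
    induction hf using Submodule.span_induction with
    | mem g hg =>
      intro a
      obtain ⟨m, hm, hgm⟩ := hS g hg
      rw [mul_comm, homogeneousComponent_mul_of_lt hgm hm]
    | zero => simp
    | add x y _ _ hx hy => intro a; rw [mul_add, map_add, hx, hy, add_zero]
    | smul b x _ hx => intro a; rw [smul_eq_mul, ← mul_assoc, hx]
  simpa using key 1

/-- The ideal is homogeneous, so the cofactor of `L` may be replaced by its component of degree `n`.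
-/
theorem exists_form_of_mem_hyperplaneSection_sup {t : ℕ} {ℓ L : MvPolynomial (Fin 4) K}
    (hℓ : ℓ.IsHomogeneous 1) (hL : L.IsHomogeneous 1) {n : ℕ} {f : MvPolynomial (Fin 4) K}
    (hf : f.IsHomogeneous (n + 1))
    (hmem : f ∈ Ideal.span {L} ⊔ hyperplaneSection (liftIdeal K t) ℓ) :
    ∃ g : MvPolynomial (Fin 4) K, g.IsHomogeneous n ∧
      f - L * g ∈ hyperplaneSection (liftIdeal K t) ℓ := by
  obtain ⟨r, u, hu, rfl⟩ := Ideal.mem_span_singleton_sup.1 hmem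
  refine ⟨homogeneousComponent n r, homogeneousComponent_isHomogeneous _ _, ?_⟩
  rw [← homogeneousComponent_eq_self hf, map_add, mul_comm r, add_comm n,
    homogeneousComponent_mul_add hL, add_sub_cancel_left]
  rw [hyperplaneSection, liftIdeal, ← Ideal.span_union] at hu ⊢
  refine homogeneousComponent_mem_span ?_ hu _
  rintro g ((rfl | rfl | rfl | rfl) | rfl)
  · exact ⟨_, isHomogeneous_gridProd _ 1⟩
  · exact ⟨_, isHomogeneous_gridProd _ 2⟩
  · exact ⟨_, isHomogeneous_gridProd _ 3⟩
  · exact ⟨_, ((isHomogeneous_X _ _).mul (isHomogeneous_X _ _)).mul (isHomogeneous_X _ _)⟩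
  · exact ⟨1, hℓ⟩

/-- `L * f` has degree at most `t`, so the three products cannot contribute and `L * f` lies in
`(xyz, ℓ)`. Then `x`, `y`, `z` are peeled off `f` in turn. -/
theorem mem_hyperplaneSection_of_mul_mem {t d : ℕ} (hd : d < t) {c : Fin 4 → K} (hc : c 0 ≠ 0)
    {L : MvPolynomial (Fin 4) K} (hL : L.IsHomogeneous 1)
    (hX : ∀ s : Fin 3, X s.succ ∉ Ideal.span {linearForm c})
    (hLX : ∀ s : Fin 3, L ∉ Ideal.span {X s.succ} ⊔ Ideal.span {linearForm c})
    {f : MvPolynomial (Fin 4) K} (hf : f.IsHomogeneous d)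
    (h : L * f ∈ hyperplaneSection (liftIdeal K t) (linearForm c)) :
    f ∈ hyperplaneSection (liftIdeal K t) (linearForm c) := by
  set P := Ideal.span {linearForm c} with hP
  have hPp : P.IsPrime := isPrime_span_linearForm hc
  -- Primality of `(X s.succ, ℓ)` divides `f` by `X s.succ` modulo `ℓ`; primality of `(ℓ)` then
  -- cancels that variable from the relation.
  have step : ∀ (s : Fin 3) (f u : MvPolynomial (Fin 4) K), L * f - X s.succ * u ∈ P →
      ∃ a, f - X s.succ * a ∈ P ∧ L * a - u ∈ P := fun s f u hfu => by
    have hpr := isPrime_span_X_sup_span_linearForm hc s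
    have h1 : L * f ∈ Ideal.span {X s.succ} ⊔ P :=
      Ideal.mem_span_singleton_sup.2 ⟨u, _, hfu, by ring⟩
    obtain ⟨a, b, hb, rfl⟩ := Ideal.mem_span_singleton_sup.1
      ((hpr.mem_or_mem h1).resolve_left (hLX s))
    refine ⟨a, by rwa [mul_comm a, add_sub_cancel_left], ?_⟩
    refine (hPp.mem_or_mem (x := X s.succ) ?_).resolve_left (hX s)
    have := P.sub_mem hfu (P.mul_mem_left L hb)
    convert this using 1
    ring
  have h0 : L * f ∈ Ideal.span {X 1 * X 2 * X 3} ⊔ P := by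
    rw [hyperplaneSection, liftIdeal_eq, sup_right_comm, sup_comm] at h
    obtain ⟨u, hu, v, hv, huv⟩ := Submodule.mem_sup.1 h
    rw [← homogeneousComponent_eq_self (hL.mul hf), ← huv, map_add]
    simp only [← Ideal.span_union] at hu
    rw [homogeneousComponent_eq_zero_of_mem_span _ hu, zero_add]
    · rw [← Ideal.span_union] at hv
      rw [hP, ← Ideal.span_union]
      refine homogeneousComponent_mem_span ?_ hv _
      rintro g (rfl | rfl)
      · exact ⟨_, ((isHomogeneous_X _ _).mul (isHomogeneous_X _ _)).mul (isHomogeneous_X _ _)⟩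
      · exact ⟨1, isHomogeneous_linearForm c⟩
    · have hlt : 1 + d < (Finset.range (t + 1)).card := by rw [Finset.card_range]; omega
      rintro g ((rfl | rfl) | rfl)
      · exact ⟨_, hlt, isHomogeneous_gridProd _ 1⟩
      · exact ⟨_, hlt, isHomogeneous_gridProd _ 2⟩
      · exact ⟨_, hlt, isHomogeneous_gridProd _ 3⟩
  obtain ⟨r, v, hv, hrv⟩ := Ideal.mem_span_singleton_sup.1 h0
  obtain ⟨a, ha, ha'⟩ := step 0 f (X 2 * X 3 * r) (by
    convert hv using 1
    rw [← hrv]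
    change _ - X 1 * _ = _
    ring)
  obtain ⟨b, hb, hb'⟩ := step 1 a (X 3 * r) (by
    convert ha' using 1
    change _ - X 2 * _ = _
    ring)
  obtain ⟨e, he, -⟩ := step 2 b r hb'
  have hfin : f = e * (X 1 * X 2 * X 3) + ((f - X 1 * a) + X 1 * (a - X 2 * b) +
      X 1 * X 2 * (b - X 3 * e)) := by ring
  rw [hfin]
  refine add_mem (Ideal.mem_sup_left (Ideal.mul_mem_left _ _ (X_mul_X_mul_X_mem_liftIdeal t)))
    (Ideal.mem_sup_right (add_mem (add_mem ha (P.mul_mem_left _ hb)) (P.mul_mem_left _ he)))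

/-- `p s` is the intersection of the line `ℓ = L = 0` with the plane `X s.succ = 0`, and `hdet` is
the determinant of the values of the three products at these points. The diagonal vanishes because
the product for `s` has the factor `X s.succ`. -/
theorem hasWLP_hyperplaneSection {t : ℕ} {c : Fin 4 → K} (hc : c 0 ≠ 0)
    {L : MvPolynomial (Fin 4) K} (hL : L.IsHomogeneous 1) {p : Fin 3 → Fin 4 → K}
    (hp : ∀ s, p s s.succ = 0) (hpne : ∀ s s', s ≠ s' → p s s'.succ ≠ 0)
    (hℓp : ∀ s, eval (p s) (linearForm c) = 0) (hLp : ∀ s, eval (p s) L = 0)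
    (hcut : ∀ s, CutsOut (Ideal.span {X s.succ} ⊔ (Ideal.span {linearForm c} ⊔ Ideal.span {L}))
      {p s})
    (hdet : ∀ F : Fin 3 → MvPolynomial (Fin 4) K,
      (∀ s, F s = gridProd K (Finset.range (t + 1)) s.succ) →
      eval (p 1) (F 0) * eval (p 2) (F 1) * eval (p 0) (F 2) +
      eval (p 2) (F 0) * eval (p 0) (F 1) * eval (p 1) (F 2) ≠ 0)
    (hLX : ∀ s : Fin 3, L ∉ Ideal.span {X s.succ} ⊔ Ideal.span {linearForm c}) :
    HasWLP (hyperplaneSection (liftIdeal K t) (linearForm c)) := by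
  set F : Fin 3 → MvPolynomial (Fin 4) K := fun s => gridProd K (Finset.range (t + 1)) s.succ
    with hF
  replace hdet := hdet F fun s => rfl
  set J := Ideal.span {linearForm c} ⊔ Ideal.span {L} with hJ
  have hℓ := isHomogeneous_linearForm c
  have hJp : ∀ s, ∀ u ∈ J, VanishesOnCone u (p s) := fun s =>
    vanishesOnCone_of_mem_sup (vanishesOnCone_of_mem_span_singleton hℓ (hℓp s))
      (vanishesOnCone_of_mem_span_singleton hL (hLp s))
  have hc2 : CutsOut (Ideal.span {X 1 * X 2} ⊔ J) ({p 0} ∪ {p 1}) := by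
    refine (hcut 0).union (isHomogeneous_X _ _) (hcut 1) ?_ ?_ ?_ le_sup_right
    · rintro q rfl
      exact hJp 1
    · rintro q rfl
      simpa using hpne 1 0 (by decide)
    · intro g hg
      obtain ⟨r, u, hu, rfl⟩ := Ideal.mem_span_singleton_sup.1 hg
      exact Ideal.mem_span_singleton_sup.2 ⟨r, u * X 1, J.mul_mem_right _ hu, by
        change _ = (r * X 2 + u) * X 1
        ring⟩
  have hc3 : CutsOut (Ideal.span {X 1 * X 2 * X 3} ⊔ J) ({p 0} ∪ {p 1} ∪ {p 2}) := by
    refine hc2.union ((isHomogeneous_X _ _).mul (isHomogeneous_X _ _)) (hcut 2) ?_ ?_ ?_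
      le_sup_right
    · rintro q rfl
      exact hJp 2
    · rintro q rfl
      simpa using ⟨hpne 2 0 (by decide), hpne 2 1 (by decide)⟩
    · intro g hg
      obtain ⟨r, u, hu, rfl⟩ := Ideal.mem_span_singleton_sup.1 hg
      exact Ideal.mem_span_singleton_sup.2 ⟨r, u * (X 1 * X 2), J.mul_mem_right _ hu, by
        change _ = (r * X 3 + u) * (X 1 * X 2)
        ring⟩
  have hFhom : ∀ s, (F s).IsHomogeneous (t + 1) := fun s => by
    simpa using isHomogeneous_gridProd (K := K) (Finset.range (t + 1)) s.succ
  have hFp : ∀ s, eval (p s) (F s) = 0 := fun s => by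
    simp only [hF, eval_gridProd]
    exact Finset.prod_eq_zero (Finset.mem_range.2 t.succ_pos) (by simp [hp s])
  -- Subtracting a combination of the three products makes `g` vanish at all three points, hence lie
  -- in `(xyz, ℓ, L)`.
  have hforms : ∀ g : MvPolynomial (Fin 4) K, g.IsHomogeneous (t + 1) →
      g ∈ Ideal.span {L} ⊔ hyperplaneSection (liftIdeal K t) (linearForm c) := fun g hg => by
    set D := eval (p 1) (F 0) * eval (p 2) (F 1) * eval (p 0) (F 2) +
      eval (p 2) (F 0) * eval (p 0) (F 1) * eval (p 1) (F 2) with hD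
    set g₀ := eval (p 0) g
    set g₁ := eval (p 1) g
    set g₂ := eval (p 2) g
    set a := eval (p 1) (F 0)
    set a' := eval (p 2) (F 0)
    set b := eval (p 0) (F 1)
    set b' := eval (p 2) (F 1)
    set e := eval (p 0) (F 2)
    set e' := eval (p 1) (F 2)
    -- Cramer's rule for the `3 × 3` system with zero diagonal and determinant `D`.
    set l₀ := (g₁ * b' * e - g₀ * b' * e' + g₂ * b * e') / D with hl₀
    set l₁ := (g₂ * e * a - g₁ * e * a' + g₀ * e' * a') / D with hl₁
    set l₂ := (g₀ * a * b' - g₂ * a * b + g₁ * a' * b) / D with hl₂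
    have hu : C l₀ * F 0 + C l₁ * F 1 + C l₂ * F 2 ∈ liftIdeal K t :=
      add_mem (add_mem (Ideal.mul_mem_left _ _ (gridProd_mem_liftIdeal t 0))
        (Ideal.mul_mem_left _ _ (gridProd_mem_liftIdeal t 1)))
        (Ideal.mul_mem_left _ _ (gridProd_mem_liftIdeal t 2))
    have hhom : (g - (C l₀ * F 0 + C l₁ * F 1 + C l₂ * F 2)).IsHomogeneous (t + 1) :=
      hg.sub ((((hFhom 0).C_mul l₀).add ((hFhom 1).C_mul l₁)).add ((hFhom 2).C_mul l₂))
    have hmem : g - (C l₀ * F 0 + C l₁ * F 1 + C l₂ * F 2) ∈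
        Ideal.span {X 1 * X 2 * X 3} ⊔ J := by
      refine hc3 _ ?_
      rintro q ((rfl | rfl) | rfl) <;> refine .of_isHomogeneous hhom ?_ <;>
        simp only [map_sub, map_add, map_mul, eval_C, hFp, mul_zero, zero_add, add_zero]
      · change g₀ - (l₁ * b + l₂ * e) = 0
        rw [hl₁, hl₂]
        field_simp
        rw [hD]
        ring
      · change g₁ - (l₀ * a + l₂ * e') = 0
        rw [hl₀, hl₂]
        field_simp
        rw [hD]
        ring
      · change g₂ - (l₀ * a' + l₁ * b') = 0
        rw [hl₀, hl₁]
        field_simp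
        rw [hD]
        ring
    have hle : Ideal.span {X 1 * X 2 * X 3} ⊔ J ≤
        Ideal.span {L} ⊔ hyperplaneSection (liftIdeal K t) (linearForm c) := by
      refine sup_le ?_ (sup_le (le_sup_right.trans le_sup_right) le_sup_left)
      rw [Ideal.span_singleton_le_iff_mem]
      exact Ideal.mem_sup_right (Ideal.mem_sup_left (X_mul_X_mul_X_mem_liftIdeal t))
    have := add_mem (hle hmem) (Ideal.mem_sup_right (Ideal.mem_sup_left hu))
    rwa [sub_add_cancel] at this
  refine hasWLP_iff.2 ⟨L, hL, fun d => ?_⟩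
  rcases lt_or_ge d t with hd | hd
  · refine Or.inl fun f hf h => mem_hyperplaneSection_of_mul_mem hd hc hL (fun s hs => ?_) hLX hf h
    obtain ⟨s', hs'⟩ := exists_ne s
    have := vanishesOnCone_of_mem_span_singleton hℓ (hℓp s') _ hs 1 one_ne_zero
    rw [one_smul, eval_X] at this
    exact hpne s' s hs' this
  · exact Or.inr fun f hf => exists_form_of_mem_hyperplaneSection_sup hℓ hL hf
      (mem_of_forms_mem hforms (by omega) hf)

/-! ### The criterion applied to `w = 0` and to a general plane. -/

theorem mem_span_sup_span_sup_span {R : Type*} [CommRing R] {f x y z : R} (a b d : R)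
    (h : f = a * x + b * y + d * z) :
    f ∈ Ideal.span {x} ⊔ (Ideal.span {y} ⊔ Ideal.span {z}) := by
  rw [h, add_assoc]
  exact Ideal.mem_span_singleton_sup.2 ⟨a, _, Ideal.mem_span_singleton_sup.2
    ⟨b, _, Ideal.mul_mem_left _ _ (Ideal.mem_span_singleton_self _), rfl⟩, rfl⟩

theorem notMem_span_X_sup_span {c : Fin 4 → K} {L : MvPolynomial (Fin 4) K} (s : Fin 3)
    {q : Fin 4 → K} (hs : q s.succ = 0) (hc : eval q (linearForm c) = 0) (hL : eval q L ≠ 0) :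
    L ∉ Ideal.span {X s.succ} ⊔ Ideal.span {linearForm c} := fun h => hL (by
  have := vanishesOnCone_of_mem_sup
    (vanishesOnCone_of_mem_span_singleton (isHomogeneous_X K s.succ) (p := q) (by simpa using hs))
    (vanishesOnCone_of_mem_span_singleton (isHomogeneous_linearForm c) hc) _ h 1 one_ne_zero
  rwa [one_smul] at this)

theorem linearForm_one_zero : linearForm ![(1 : K), 0, 0, 0] = X 0 := by
  simp [linearForm, Fin.sum_univ_four]

theorem isArtinianRing_hyperplaneSection_X_zero (t : ℕ) :
    IsArtinianRing (MvPolynomial (Fin 4) K ⧸ hyperplaneSection (liftIdeal K t) (X 0)) := by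
  rw [← linearForm_one_zero]
  refine isArtinianRing_hyperplaneSection ?_
  rintro p ⟨i, j, k, -, -, -, -, rfl⟩
  simp [linearForm_one_zero]

/-- At points with `w = 0` the products are pure powers, and the determinant for `L = x + y + z` is
`1 + (-1)^(t+1) = 2`. -/
theorem hasWLP_hyperplaneSection_X_zero [Infinite K] {t : ℕ} (ht : Odd t) (h2 : (2 : K) ≠ 0) :
    HasWLP (hyperplaneSection (liftIdeal K t) (X 0)) := by
  rw [← linearForm_one_zero]
  refine hasWLP_hyperplaneSection (by simp) (L := X 1 + X 2 + X 3)
    (p := ![![0, 0, 1, -1], ![0, 1, 0, -1], ![0, 1, -1, 0]])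
    (((isHomogeneous_X _ _).add (isHomogeneous_X _ _)).add (isHomogeneous_X _ _))
    ?_ ?_ ?_ ?_ ?_ ?_ ?_
  · intro s
    fin_cases s <;> rfl
  · intro s s' hs
    fin_cases s <;> fin_cases s' <;> simp at hs ⊢
  · intro s
    fin_cases s <;> simp [linearForm_one_zero]
  · intro s
    fin_cases s <;> simp
  · rw [linearForm_one_zero]
    intro s
    fin_cases s
    · refine cutsOut_singleton (j := 2) (by simp) fun m => ?_
      fin_cases m
      · exact mem_span_sup_span_sup_span 0 1 0 (by simp)
      · exact mem_span_sup_span_sup_span 1 0 0 (by simp)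
      · exact mem_span_sup_span_sup_span 0 0 0 (by simp)
      · exact mem_span_sup_span_sup_span (-1) 0 1 (by simp; ring)
    · refine cutsOut_singleton (j := 1) (by simp) fun m => ?_
      fin_cases m
      · exact mem_span_sup_span_sup_span 0 1 0 (by simp)
      · exact mem_span_sup_span_sup_span 0 0 0 (by simp)
      · exact mem_span_sup_span_sup_span 1 0 0 (by simp)
      · exact mem_span_sup_span_sup_span (-1) 0 1 (by simp; ring)
    · refine cutsOut_singleton (j := 1) (by simp) fun m => ?_
      fin_cases m
      · exact mem_span_sup_span_sup_span 0 1 0 (by simp)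
      · exact mem_span_sup_span_sup_span 0 0 0 (by simp)
      · exact mem_span_sup_span_sup_span (-1) 0 1 (by simp; ring)
      · exact mem_span_sup_span_sup_span 1 0 0 (by simp)
  · intro F hF
    simp only [hF, eval_gridProd]
    have : (-1 : K) ^ (t + 1) = 1 := ht.add_one.neg_one_pow
    simp [Finset.prod_const, this, one_add_one_eq_two, h2]
  · intro s
    fin_cases s
    · exact notMem_span_X_sup_span 0 (q := ![0, 0, 1, 0]) rfl (by simp [linearForm_one_zero])
        (by simp)
    · exact notMem_span_X_sup_span 1 (q := ![0, 1, 0, 0]) rfl (by simp [linearForm_one_zero])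
        (by simp)
    · exact notMem_span_X_sup_span 2 (q := ![0, 1, 0, 0]) rfl (by simp [linearForm_one_zero])
        (by simp)

/-- With `L = w - αx`, two of the three points satisfy `w = αx`, and the one on `x = 0` has `w = 0`.
The determinant then factors as `(c 2 * c 3)^(t+1) * ∏ (1 - nα)` times the expression in `hD`. -/
theorem hasWLP_hyperplaneSection_of_ne [Infinite K] {t : ℕ} {c : Fin 4 → K} {α : K}
    (hα : ∏ n ∈ Finset.range (t + 1), (1 - n * α) ≠ 0) (h0 : c 0 ≠ 0) (h2 : c 2 ≠ 0)
    (h3 : c 3 ≠ 0) (he : α * c 0 + c 1 ≠ 0)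
    (hD : (-1) ^ (t + 1) * ∏ n ∈ Finset.range (t + 1), (-(α * c 0 + c 1) - n * (α * c 2)) +
      ∏ n ∈ Finset.range (t + 1), (-(α * c 0 + c 1) - n * (α * c 3)) ≠ 0) :
    HasWLP (hyperplaneSection (liftIdeal K t) (linearForm c)) := by
  set e := α * c 0 + c 1 with hedef
  have hℓ : linearForm c = C (c 0) * X 0 + C (c 1) * X 1 + C (c 2) * X 2 + C (c 3) * X 3 := by
    rw [linearForm, Fin.sum_univ_four]
  have hℓe : ∀ q, eval q (linearForm c) = c 0 * q 0 + c 1 * q 1 + c 2 * q 2 + c 3 * q 3 := by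
    intro q
    simp [hℓ]
  refine hasWLP_hyperplaneSection h0 (L := X 0 - C α * X 1)
    (p := ![![0, 0, c 3, -c 2], ![α * c 3, c 3, 0, -e], ![α * c 2, c 2, -e, 0]])
    ((isHomogeneous_X _ _).sub (isHomogeneous_C_mul_X _ _)) ?_ ?_ ?_ ?_ ?_ ?_ ?_
  · intro s
    fin_cases s <;> rfl
  · intro s s' hs
    fin_cases s <;> fin_cases s' <;> simp [h2, h3, he] at hs ⊢
  · intro s
    fin_cases s <;> simp [hℓe, hedef] <;> ring
  · intro s
    fin_cases s <;> simp
  · intro s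
    fin_cases s
    · refine cutsOut_singleton (j := 2) (by simpa using h3) fun m => ?_
      fin_cases m
      · exact mem_span_sup_span_sup_span (C (c 3) * C α) 0 (C (c 3)) (by simp; ring)
      · exact mem_span_sup_span_sup_span (C (c 3)) 0 0 (by simp)
      · exact mem_span_sup_span_sup_span 0 0 0 (by simp)
      · exact mem_span_sup_span_sup_span (-C e) 1 (-C (c 0)) (by simp [hℓ, hedef]; ring)
    · refine cutsOut_singleton (j := 1) (by simpa using h3) fun m => ?_
      fin_cases m
      · exact mem_span_sup_span_sup_span 0 0 (C (c 3)) (by simp; ring)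
      · exact mem_span_sup_span_sup_span 0 0 0 (by simp)
      · exact mem_span_sup_span_sup_span (C (c 3)) 0 0 (by simp)
      · exact mem_span_sup_span_sup_span (-C (c 2)) 1 (-C (c 0)) (by simp [hℓ, hedef]; ring)
    · refine cutsOut_singleton (j := 1) (by simpa using h2) fun m => ?_
      fin_cases m
      · exact mem_span_sup_span_sup_span 0 0 (C (c 2)) (by simp; ring)
      · exact mem_span_sup_span_sup_span 0 0 0 (by simp)
      · exact mem_span_sup_span_sup_span (-C (c 3)) 1 (-C (c 0)) (by simp [hℓ, hedef]; ring)
      · exact mem_span_sup_span_sup_span (C (c 2)) 0 0 (by simp)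
  · intro F hF
    simp only [hF, eval_gridProd]
    have hscale : ∀ a : K, ∏ n ∈ Finset.range (t + 1), (a - n * (α * a)) =
        a ^ (t + 1) * ∏ n ∈ Finset.range (t + 1), (1 - n * α) := fun a => by
      have : a ^ (t + 1) = ∏ n ∈ Finset.range (t + 1), a := by simp
      rw [this, ← Finset.prod_mul_distrib]
      exact Finset.prod_congr rfl fun n _ => by ring
    have key : c 3 ^ (t + 1) * c 2 ^ (t + 1) * (∏ n ∈ Finset.range (t + 1), (1 - n * α)) *
        ((-1) ^ (t + 1) * ∏ n ∈ Finset.range (t + 1), (-e - n * (α * c 2)) +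
        ∏ n ∈ Finset.range (t + 1), (-e - n * (α * c 3))) ≠ 0 :=
      mul_ne_zero (mul_ne_zero (mul_ne_zero (pow_ne_zero _ h3) (pow_ne_zero _ h2)) hα) hD
    convert key using 1
    change (∏ n ∈ Finset.range (t + 1), (c 3 - n * (α * c 3))) *
      (∏ n ∈ Finset.range (t + 1), (-e - n * (α * c 2))) *
      (∏ n ∈ Finset.range (t + 1), (-c 2 - n * 0)) +
      (∏ n ∈ Finset.range (t + 1), (c 2 - n * (α * c 2))) *
      (∏ n ∈ Finset.range (t + 1), (c 3 - n * 0)) *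
      (∏ n ∈ Finset.range (t + 1), (-e - n * (α * c 3))) = _
    rw [hscale, hscale]
    simp only [mul_zero, sub_zero, Finset.prod_const, Finset.card_range]
    rw [neg_pow (c 2)]
    ring
  · intro s
    fin_cases s
    · exact notMem_span_X_sup_span 0 (q := ![c 3, 0, 0, -c 0]) rfl (by simp [hℓe]; ring)
        (by simpa using h3)
    · exact notMem_span_X_sup_span 1 (q := ![c 3, 0, 0, -c 0]) rfl (by simp [hℓe]; ring)
        (by simpa using h3)
    · exact notMem_span_X_sup_span 2 (q := ![c 2, 0, -c 0, 0]) rfl (by simp [hℓe]; ring)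
        (by simpa using h2)

/-- Only `0` and the finitely many values `±1/n` must be avoided. -/
theorem exists_prod_one_sub_ne_zero [Infinite K] (t : ℕ) : ∃ α : K, α ≠ 0 ∧
    ∏ n ∈ Finset.range (t + 1), (1 - n * α) ≠ 0 ∧
    ∏ n ∈ Finset.range (t + 1), (1 + n * α) ≠ 0 := by
  classical
  obtain ⟨α, hα⟩ := Infinite.exists_notMem_finset (insert (0 : K)
    ((Finset.range (t + 1)).image (fun n : ℕ => (n : K)⁻¹) ∪
      (Finset.range (t + 1)).image (fun n : ℕ => -(n : K)⁻¹)))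
  simp only [Finset.mem_insert, Finset.mem_union, Finset.mem_image, not_or, not_exists,
    not_and] at hα
  obtain ⟨h0, h1, h2⟩ := hα
  refine ⟨α, h0, Finset.prod_ne_zero_iff.2 fun n hn h => h1 n hn ?_,
    Finset.prod_ne_zero_iff.2 fun n hn h => h2 n hn ?_⟩
  · exact inv_eq_of_mul_eq_one_right (by linear_combination -h)
  · rw [neg_eq_iff_eq_neg]
    exact inv_eq_of_mul_eq_one_right (by linear_combination -h)

theorem forGeneralLinearForm_of_polynomial {σ : Type*} [Fintype σ] [Infinite K]
    {P : MvPolynomial σ K → Prop} (D : MvPolynomial σ K) (hD : D ≠ 0)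
    (h : ∀ c : σ → K, eval c D ≠ 0 → P (linearForm c)) : ForGeneralLinearForm P := by
  refine ⟨Ideal.span {D}, ?_, fun c hc => h c fun h0 => hc ?_⟩
  · obtain ⟨c, hc⟩ : ∃ c : σ → K, eval c D ≠ 0 := by
      by_contra hcon
      push Not at hcon
      exact hD (MvPolynomial.funext fun c => by rw [hcon c, map_zero])
    refine ⟨c, fun hmem => hc ?_⟩
    simpa [aeval_eq_eval] using hmem D (Ideal.mem_span_singleton_self D)
  · intro f hf
    obtain ⟨r, rfl⟩ := Ideal.mem_span_singleton'.1 hf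
    simp [aeval_eq_eval, h0]

theorem ne_zero_of_eval_ne_zero {σ : Type*} {f : MvPolynomial σ K} (c : σ → K)
    (h : eval c f ≠ 0) : f ≠ 0 := by
  rintro rfl
  exact h (map_zero _)

/-- Once `α` is fixed, every requirement is the nonvanishing of a polynomial in the coefficients
`c`. `P` is the product of the values of the linear form at all grid points; it gives the Artinian
property and `c 0 ≠ 0`. -/
theorem forGeneralLinearForm_hasWLP [Infinite K] {t : ℕ} (ht : 1 ≤ t) :
    ForGeneralLinearForm (fun ℓ : MvPolynomial (Fin 4) K =>
      IsArtinianRing (MvPolynomial (Fin 4) K ⧸ hyperplaneSection (liftIdeal K t) ℓ) ∧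
      HasWLP (hyperplaneSection (liftIdeal K t) ℓ)) := by
  obtain ⟨α, hα0, hα, hα'⟩ := exists_prod_one_sub_ne_zero (K := K) t
  set A := Finset.range (t + 1) with hA
  set P : MvPolynomial (Fin 4) K :=
    ∏ i ∈ A, ∏ j ∈ A, ∏ k ∈ A, (X 0 + C (i : K) * X 1 + C (j : K) * X 2 + C (k : K) * X 3) with hP
  set e : MvPolynomial (Fin 4) K := C α * X 0 + X 1 with he
  set D : MvPolynomial (Fin 4) K := (-1) ^ (t + 1) * ∏ n ∈ A, (-e - C (n : K) * (C α * X 2)) +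
      ∏ n ∈ A, (-e - C (n : K) * (C α * X 3)) with hD
  have hPe : ∀ c, eval c P =
      ∏ i ∈ A, ∏ j ∈ A, ∏ k ∈ A, (c 0 + (i : K) * c 1 + (j : K) * c 2 + (k : K) * c 3) := fun c => by
    simp [hP, map_prod]
  have hee : ∀ c, eval c e = α * c 0 + c 1 := fun c => by simp [he]
  have hDe : ∀ c, eval c D = (-1) ^ (t + 1) * ∏ n ∈ A, (-(α * c 0 + c 1) - n * (α * c 2)) +
      ∏ n ∈ A, (-(α * c 0 + c 1) - n * (α * c 3)) := fun c => by
    simp [hD, map_prod, hee]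
  have hP0 : P ≠ 0 := ne_zero_of_eval_ne_zero ![1, 0, 0, 0] (by simp [hPe])
  have he0 : e ≠ 0 := ne_zero_of_eval_ne_zero ![0, 1, 0, 0] (by simp [hee])
  -- At this point `e = 1`; the coefficient `-α⁻¹` kills the first product at `n = 1`, an index
  -- available since `t ≥ 1`, and the second becomes `±∏ (1 + nα)`.
  have hD0 : D ≠ 0 := ne_zero_of_eval_ne_zero ![0, 1, -α⁻¹, 1] (by
    rw [hDe, Finset.prod_eq_zero (s := A) (i := 1) (by simp [hA]; omega)
      (by simp [hα0]), mul_zero, zero_add]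
    have h1 : ∏ n ∈ A, (-(α * (![0, 1, -α⁻¹, 1] : Fin 4 → K) 0 + (![0, 1, -α⁻¹, 1] : Fin 4 → K) 1) -
        n * (α * (![0, 1, -α⁻¹, 1] : Fin 4 → K) 3)) = ∏ n ∈ A, -(1 + n * α) :=
      Finset.prod_congr rfl fun n _ => by simp; ring
    rw [h1, Finset.prod_neg]
    exact mul_ne_zero (pow_ne_zero _ (by simp)) hα')
  refine forGeneralLinearForm_of_polynomial (P * (X 2 * X 3) * e * D)
    (mul_ne_zero (mul_ne_zero (mul_ne_zero hP0 (mul_ne_zero (X_ne_zero _) (X_ne_zero _))) he0) hD0)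
    fun c hc => ?_
  simp only [map_mul, eval_X, mul_ne_zero_iff, hPe, hee, hDe] at hc
  obtain ⟨⟨⟨hcP, hc2, hc3⟩, hce⟩, hcD⟩ := hc
  have hgrid : ∀ i j k : ℕ, i ≤ t → j ≤ t → k ≤ t →
      c 0 + (i : K) * c 1 + (j : K) * c 2 + (k : K) * c 3 ≠ 0 := fun i j k hi hj hk => by
    have h1 := Finset.prod_ne_zero_iff.1 hcP i (by simp [hA]; omega)
    have h2 := Finset.prod_ne_zero_iff.1 h1 j (by simp [hA]; omega)
    exact Finset.prod_ne_zero_iff.1 h2 k (by simp [hA]; omega)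
  refine ⟨isArtinianRing_hyperplaneSection ?_, hasWLP_hyperplaneSection_of_ne hα ?_ hc2 hc3 hce hcD⟩
  · rintro p ⟨i, j, k, hi, hj, hk, -, rfl⟩
    have := hgrid i j k hi hj hk
    rw [eval_linearForm, Fin.sum_univ_four]
    simp only [gridPoint_zero, gridPoint_one, gridPoint_two, gridPoint_three]
    convert this using 1
    ring
  · simpa using hgrid 0 0 0 t.zero_le t.zero_le t.zero_le

/-! ### The monomial ideal at `w = 0` and failure of the weak Lefschetz property. -/

theorem exists_eq_linearForm {σ : Type*} [Fintype σ] {h : MvPolynomial σ K}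
    (hh : h.IsHomogeneous 1) : ∃ c : σ → K, h = linearForm c := by
  have h1 : h ∈ homogeneousSubmodule σ K 1 := hh
  rw [homogeneousSubmodule_one_eq_span_X, Submodule.mem_span_range_iff_exists_fun] at h1
  obtain ⟨c, rfl⟩ := h1
  exact ⟨c, Finset.sum_congr rfl fun i _ => by rw [C_mul']⟩

/-- The exponents of the monomials in the ideal `(w, x^(t+1), y^(t+1), z^(t+1), xyz)`. -/
def IsInitialExponent (t : ℕ) (m : Fin 4 →₀ ℕ) : Prop :=
  1 ≤ m 0 ∨ t + 1 ≤ m 1 ∨ t + 1 ≤ m 2 ∨ t + 1 ≤ m 3 ∨ (1 ≤ m 1 ∧ 1 ≤ m 2 ∧ 1 ≤ m 3)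

theorem gridProd_sub_X_pow_mem (A : Finset ℕ) (i : Fin 4) :
    gridProd K A i - X i ^ A.card ∈ Ideal.span {(X 0 : MvPolynomial (Fin 4) K)} := by
  rw [← Ideal.Quotient.eq, gridProd, map_prod, map_pow]
  refine Finset.prod_eq_pow_card fun n _ => Ideal.Quotient.eq.2 ?_
  rw [sub_sub_cancel_left]
  exact neg_mem (Ideal.mul_mem_left _ _ (Ideal.mem_span_singleton_self _))

theorem hyperplaneSection_X_zero_eq (t : ℕ) : hyperplaneSection (liftIdeal K t) (X 0) =
    Ideal.span ({X 0, X 1 ^ (t + 1), X 2 ^ (t + 1), X 3 ^ (t + 1), X 1 * X 2 * X 3} :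
      Set (MvPolynomial (Fin 4) K)) := by
  have hsub : ∀ i : Fin 4, ∀ J : Ideal (MvPolynomial (Fin 4) K), X 0 ∈ J →
      (gridProd K (Finset.range (t + 1)) i ∈ J ↔ X i ^ (t + 1) ∈ J) := fun i J hJ => by
    have h := gridProd_sub_X_pow_mem (K := K) (Finset.range (t + 1)) i
    rw [Finset.card_range] at h
    have h' := (Ideal.span_singleton_le_iff_mem J).2 hJ h
    exact ⟨fun h1 => by simpa using J.sub_mem h1 h', fun h1 => by simpa using J.add_mem h1 h'⟩
  apply le_antisymm
  · set J := Ideal.span ({X 0, X 1 ^ (t + 1), X 2 ^ (t + 1), X 3 ^ (t + 1), X 1 * X 2 * X 3} :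
      Set (MvPolynomial (Fin 4) K))
    have h0 : X 0 ∈ J := Ideal.subset_span (by simp)
    refine sup_le (Ideal.span_le.2 ?_) ((Ideal.span_singleton_le_iff_mem J).2 h0)
    rintro g (rfl | rfl | rfl | rfl)
    · exact (hsub 1 J h0).2 (Ideal.subset_span (by simp))
    · exact (hsub 2 J h0).2 (Ideal.subset_span (by simp))
    · exact (hsub 3 J h0).2 (Ideal.subset_span (by simp))
    · exact Ideal.subset_span (by simp)
  · set J := hyperplaneSection (liftIdeal K t) (X 0)
    have h0 : X 0 ∈ J := Ideal.mem_sup_right (Ideal.mem_span_singleton_self _)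
    refine Ideal.span_le.2 ?_
    rintro g (rfl | rfl | rfl | rfl | rfl)
    · exact h0
    · exact (hsub 1 J h0).1 (Ideal.mem_sup_left (gridProd_mem_liftIdeal t 0))
    · exact (hsub 2 J h0).1 (Ideal.mem_sup_left (gridProd_mem_liftIdeal t 1))
    · exact (hsub 3 J h0).1 (Ideal.mem_sup_left (gridProd_mem_liftIdeal t 2))
    · exact Ideal.mem_sup_left (X_mul_X_mul_X_mem_liftIdeal t)

theorem mem_hyperplaneSection_X_zero_iff {t : ℕ} {f : MvPolynomial (Fin 4) K} :
    f ∈ hyperplaneSection (liftIdeal K t) (X 0) ↔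
      ∀ m, coeff m f ≠ 0 → IsInitialExponent t m := by
  set S : Set (Fin 4 →₀ ℕ) := {Finsupp.single 0 1, Finsupp.single 1 (t + 1),
    Finsupp.single 2 (t + 1), Finsupp.single 3 (t + 1),
    Finsupp.single 1 1 + Finsupp.single 2 1 + Finsupp.single 3 1} with hS
  have himg : ({X 0, X 1 ^ (t + 1), X 2 ^ (t + 1), X 3 ^ (t + 1), X 1 * X 2 * X 3} :
      Set (MvPolynomial (Fin 4) K)) = (fun s => monomial s (1 : K)) '' S := by
    simp only [hS, Set.image_insert_eq, Set.image_singleton, X, monomial_pow, monomial_mul,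
      one_pow, mul_one, Finsupp.smul_single, smul_eq_mul]
  rw [hyperplaneSection_X_zero_eq, himg, mem_ideal_span_monomial_image]
  refine forall_congr' fun m => ?_
  rw [mem_support_iff]
  refine imp_congr_right fun _ => ?_
  simp only [hS, Set.mem_insert_iff, Set.mem_singleton_iff, exists_eq_or_imp, exists_eq_left,
    Finsupp.single_le_iff, IsInitialExponent]
  refine or_congr_right (or_congr_right (or_congr_right (or_congr_right ?_)))
  rw [Finsupp.le_def]
  simp [Fin.forall_fin_succ, Finsupp.single_apply]

theorem coeff_eq_zero_of_mem {t : ℕ} {f : MvPolynomial (Fin 4) K}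
    (hf : f ∈ hyperplaneSection (liftIdeal K t) (X 0)) {m : Fin 4 →₀ ℕ}
    (hm : ¬ IsInitialExponent t m) : coeff m f = 0 :=
  not_not.1 fun h => hm (mem_hyperplaneSection_X_zero_iff.1 hf m h)

theorem not_isInitialExponent_single {t : ℕ} {i : Fin 4} (hi : i ≠ 0) :
    ¬ IsInitialExponent t (Finsupp.single i t) := by
  fin_cases i <;> simp [IsInitialExponent] at hi ⊢

theorem coeff_single_add_mul {i j l : Fin 4} (hij : i ≠ j) (hil : i ≠ l) (t : ℕ) (k : K)
    (g g' : MvPolynomial (Fin 4) K) :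
    coeff (Finsupp.single i t) (C k * X i ^ t + X j * g + X l * g') = k := by
  classical
  rw [coeff_add, coeff_add, coeff_X_mul', coeff_X_mul', if_neg, if_neg, coeff_C_mul, coeff_X_pow,
    if_pos rfl, mul_one, add_zero, add_zero]
  · simp [hil]
  · simp [hij]

theorem coeff_linearForm_mul (c : Fin 4 → K) (g : MvPolynomial (Fin 4) K) {i j : Fin 4}
    (hci : c i = 0) (t : ℕ) :
    coeff (Finsupp.single j 1 + Finsupp.single i t) (linearForm c * g) =
      c j * coeff (Finsupp.single i t) g := by
  classical
  rw [linearForm, Finset.sum_mul, coeff_sum, Finset.sum_eq_single j]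
  · rw [mul_assoc, coeff_C_mul, coeff_X_mul]
  · intro k _ hk
    rw [mul_assoc, coeff_C_mul, coeff_X_mul']
    by_cases hki : k = i
    · rw [hki, hci, zero_mul]
    · rw [if_neg, mul_zero]
      simp [Ne.symm hk, Ne.symm hki]
  · simp

theorem not_isInitialExponent_single_add {t : ℕ} (ht : 1 ≤ t) {i j : Fin 4} (hi : i ≠ 0)
    (hj : j ≠ 0) (hij : i ≠ j) :
    ¬ IsInitialExponent t (Finsupp.single j 1 + Finsupp.single i t) := by
  fin_cases i <;> fin_cases j <;> simp [IsInitialExponent] at hi hj hij ⊢ <;> omega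

/-- When `c i = 0`, the coefficients of `x_j x_i^t` and `x_l x_i^t` in `L * g` are `c j` and `c l`
times the same coefficient of `g`. Hitting the monomial `x_j x_i^t` forces the first to be `1` and
the second `0`. Exchanging `j` and `l` gives a contradiction. -/
theorem eq_zero_of_surjective_of_eq_zero {t : ℕ} (ht : 1 ≤ t) {c : Fin 4 → K}
    (h : ∀ f : MvPolynomial (Fin 4) K, f.IsHomogeneous (t + 1) →
        ∃ g : MvPolynomial (Fin 4) K, g.IsHomogeneous t ∧
          f - linearForm c * g ∈ hyperplaneSection (liftIdeal K t) (X 0))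
    {i j l : Fin 4} (hi : i ≠ 0) (hj : j ≠ 0) (hl : l ≠ 0) (hij : i ≠ j) (hil : i ≠ l)
    (hjl : j ≠ l) (hci : c i = 0) : c j ≠ 0 ∧ c l = 0 := by
  classical
  obtain ⟨g, -, hg⟩ := h (monomial (Finsupp.single j 1 + Finsupp.single i t) 1)
    (isHomogeneous_monomial _ (by rw [map_add, Finsupp.degree_single, Finsupp.degree_single,
      add_comm]))
  have h1 := coeff_eq_zero_of_mem hg (not_isInitialExponent_single_add ht hi hj hij)
  have h2 := coeff_eq_zero_of_mem hg (not_isInitialExponent_single_add ht hi hl hil)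
  rw [coeff_sub, coeff_linearForm_mul c g hci, coeff_monomial, if_pos rfl] at h1
  rw [coeff_sub, coeff_linearForm_mul c g hci, coeff_monomial, if_neg, zero_sub,
    neg_eq_zero] at h2
  · have h3 : c j * coeff (Finsupp.single i t) g ≠ 0 := by
      rw [← sub_eq_zero.1 h1]
      exact one_ne_zero
    exact ⟨left_ne_zero_of_mul h3, (mul_eq_zero.1 h2).resolve_right (right_ne_zero_of_mul h3)⟩
  · intro he
    have := DFunLike.congr_fun he j
    simp [hij, hjl.symm] at this

/-- The three points are where `ax + by + ez = 0` meets the coordinate lines of `w = 0`. The weights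
form a left kernel vector of the value matrix of `x^(t+1), y^(t+1), z^(t+1)`, which is singular
because `(-1)^(t+1) = -1`. -/
theorem alternating_eval_eq_zero {t : ℕ} (hsign : (-1 : K) ^ t = 1) (a b e : K)
    {u : MvPolynomial (Fin 4) K} (hu : u.IsHomogeneous (t + 1))
    (hmem : u ∈ hyperplaneSection (liftIdeal K t) (X 0)) :
    a ^ (t + 1) * eval ![0, 0, e, -b] u - b ^ (t + 1) * eval ![0, e, 0, -a] u +
      e ^ (t + 1) * eval ![0, b, -a, 0] u = 0 := by
  have hmon : ∀ m ∈ u.support, a ^ (t + 1) * eval ![0, 0, e, -b] (monomial m (coeff m u)) -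
      b ^ (t + 1) * eval ![0, e, 0, -a] (monomial m (coeff m u)) +
      e ^ (t + 1) * eval ![0, b, -a, 0] (monomial m (coeff m u)) = 0 := fun m hm => by
    rw [mem_support_iff] at hm
    have hin := mem_hyperplaneSection_X_zero_iff.1 hmem m hm
    have hdeg : m 0 + m 1 + m 2 + m 3 = t + 1 := by
      have : m.degree = t + 1 := by
        by_contra hne
        exact hm (hu.coeff_eq_zero hne)
      rw [← this, Finsupp.degree_eq_sum, Fin.sum_univ_four]
    simp only [eval_monomial, Finsupp.prod_fintype _ _ (fun _ => pow_zero _), Fin.prod_univ_four]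
    change a ^ (t + 1) * (_ * (0 ^ m 0 * 0 ^ m 1 * e ^ m 2 * (-b) ^ m 3)) -
      b ^ (t + 1) * (_ * (0 ^ m 0 * e ^ m 1 * 0 ^ m 2 * (-a) ^ m 3)) +
      e ^ (t + 1) * (_ * (0 ^ m 0 * b ^ m 1 * (-a) ^ m 2 * 0 ^ m 3)) = 0
    have hneg : ∀ v : K, (-v) ^ (t + 1) = -v ^ (t + 1) := fun v => by
      rw [neg_pow, pow_succ (-1 : K), hsign]
      ring
    rcases hin with h | h | h | h | ⟨h1, h2, h3⟩
    · rw [zero_pow (by omega : m 0 ≠ 0)]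
      ring
    · rw [(by omega : m 0 = 0), (by omega : m 1 = t + 1), (by omega : m 2 = 0),
        (by omega : m 3 = 0)]
      simp only [pow_zero, zero_pow t.succ_ne_zero]
      ring
    · rw [(by omega : m 0 = 0), (by omega : m 2 = t + 1), (by omega : m 1 = 0),
        (by omega : m 3 = 0)]
      simp only [pow_zero, zero_pow t.succ_ne_zero, hneg]
      ring
    · rw [(by omega : m 0 = 0), (by omega : m 3 = t + 1), (by omega : m 1 = 0),
        (by omega : m 2 = 0)]
      simp only [pow_zero, zero_pow t.succ_ne_zero, hneg]
      ring
    · rw [zero_pow (by omega : m 1 ≠ 0), zero_pow (by omega : m 2 ≠ 0),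
        zero_pow (by omega : m 3 ≠ 0)]
      ring
  rw [u.as_sum]
  simp only [map_sum, Finset.mul_sum, ← Finset.sum_sub_distrib, ← Finset.sum_add_distrib]
  exact Finset.sum_eq_zero hmon

/-- After all of `c 1, c 2, c 3` are shown nonzero, the functional above kills the ideal and all
multiples of `L` in degree `t + 1`. On `y z^t` only the point with `x = 0` contributes, and that
term is nonzero. -/
theorem not_surjective_of_neg_one_pow_eq_one {t : ℕ} (ht : 1 ≤ t) (hsign : (-1 : K) ^ t = 1)
    (c : Fin 4 → K) :
    ¬ ∀ f : MvPolynomial (Fin 4) K, f.IsHomogeneous (t + 1) →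
        ∃ g : MvPolynomial (Fin 4) K, g.IsHomogeneous t ∧
          f - linearForm c * g ∈ hyperplaneSection (liftIdeal K t) (X 0) := by
  intro h
  have hne : ∀ i j l : Fin 4, i ≠ 0 → j ≠ 0 → l ≠ 0 → i ≠ j → i ≠ l → j ≠ l → c i ≠ 0 :=
    fun i j l hi hj hl hij hil hjl hci =>
      (eq_zero_of_surjective_of_eq_zero ht h hi hj hl hij hil hjl hci).1
        (eq_zero_of_surjective_of_eq_zero ht h hi hl hj hil hij hjl.symm hci).2
  have h1 := hne 1 2 3 (by decide) (by decide) (by decide) (by decide) (by decide) (by decide)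
  have h2 := hne 2 1 3 (by decide) (by decide) (by decide) (by decide) (by decide) (by decide)
  have h3 := hne 3 1 2 (by decide) (by decide) (by decide) (by decide) (by decide) (by decide)
  have hF : (X 2 * X 3 ^ t : MvPolynomial (Fin 4) K).IsHomogeneous (t + 1) := by
    have := (isHomogeneous_X K (2 : Fin 4)).mul (isHomogeneous_X_pow (R := K) (3 : Fin 4) t)
    rwa [add_comm] at this
  obtain ⟨g, hg, hmem⟩ := h _ hF
  have hLg : (linearForm c * g).IsHomogeneous (t + 1) := by
    have := (isHomogeneous_linearForm c).mul hg
    rwa [add_comm] at this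
  have hzero := alternating_eval_eq_zero hsign (c 1) (c 2) (c 3) (hF.sub hLg) hmem
  have hp1 : eval ![0, 0, c 3, -c 2] (linearForm c) = 0 := by
    simp [eval_linearForm, Fin.sum_univ_four]; ring
  have hp2 : eval ![0, c 3, 0, -c 1] (linearForm c) = 0 := by
    simp [eval_linearForm, Fin.sum_univ_four]; ring
  have hp3 : eval ![0, c 2, -c 1, 0] (linearForm c) = 0 := by
    simp [eval_linearForm, Fin.sum_univ_four]; ring
  simp only [map_sub, map_mul, hp1, hp2, hp3, map_pow, eval_X, zero_mul, sub_zero] at hzero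
  have : c 1 ^ (t + 1) * (c 3 * (-c 2) ^ t) = 0 := by
    simpa [zero_pow (by omega : t ≠ 0)] using hzero
  exact mul_ne_zero (pow_ne_zero _ h1) (mul_ne_zero h3 (pow_ne_zero _ (neg_ne_zero.2 h2))) this

/-- With `x, y, z` rescaled so that `L = x + y + z` modulo `w`, the kernel element is `x^t + y^t +
z^t` corrected by terms cancelling `xy^t + x^t y` and its analogues, leaving pure `(t+1)`-st powers
and multiples of `xyz`. -/
theorem not_injective_of_neg_one_pow_eq_one {t : ℕ} (ht : 1 ≤ t) (hsign : (-1 : K) ^ t = 1)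
    (c : Fin 4 → K) :
    ¬ ∀ f : MvPolynomial (Fin 4) K, f.IsHomogeneous t →
        linearForm c * f ∈ hyperplaneSection (liftIdeal K t) (X 0) →
          f ∈ hyperplaneSection (liftIdeal K t) (X 0) := by
  intro h
  obtain ⟨s, rfl⟩ : ∃ s, t = s + 1 := ⟨t - 1, by omega⟩
  set I := hyperplaneSection (liftIdeal K (s + 1)) (X 0) with hI
  have hX0 : X 0 ∈ I := Ideal.mem_sup_right (Ideal.mem_span_singleton_self _)
  have hX : ∀ i : Fin 3, X i.succ ^ (s + 1 + 1) ∈ I := fun i => by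
    rw [hI, hyperplaneSection_X_zero_eq]
    fin_cases i <;> exact Ideal.subset_span (by simp)
  have hXXX : X 1 * X 2 * X 3 ∈ I := Ideal.mem_sup_left (X_mul_X_mul_X_mem_liftIdeal _)
  -- `q u v` is the quotient `(u^s + v^s)/(u + v)`, a polynomial because `(-1)^s = -1`.
  set q : MvPolynomial (Fin 4) K → MvPolynomial (Fin 4) K → MvPolynomial (Fin 4) K :=
    fun u v => ∑ i ∈ Finset.range s, u ^ i * (-v) ^ (s - 1 - i) with hq
  have hsign' : (-1 : MvPolynomial (Fin 4) K) ^ s = -1 := by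
    have : (-1 : MvPolynomial (Fin 4) K) ^ (s + 1) = 1 := by
      have := congrArg (C : K → MvPolynomial (Fin 4) K) hsign
      simpa using this
    rw [pow_succ] at this
    linear_combination -this
  have hqmul : ∀ u v, q u v * (u + v) = u ^ s + v ^ s := fun u v => by
    have := geom_sum₂_mul u (-v) s
    rw [sub_neg_eq_add, neg_pow v, hsign'] at this
    rw [hq]
    linear_combination this
  have hqhom : ∀ {u v : MvPolynomial (Fin 4) K}, u.IsHomogeneous 1 → v.IsHomogeneous 1 →
      (u * v * q u v).IsHomogeneous (s + 1) := fun {u v} hu hv => by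
    rw [hq, Finset.mul_sum]
    refine IsHomogeneous.sum _ _ _ fun i hi => ?_
    have := (hu.mul hv).mul ((hu.pow i).mul (hv.neg.pow (s - 1 - i)))
    convert this using 1
    have := Finset.mem_range.1 hi
    omega
  set x : MvPolynomial (Fin 4) K := C (c 1) * X 1 with hx
  set y : MvPolynomial (Fin 4) K := C (c 2) * X 2 with hy
  set z : MvPolynomial (Fin 4) K := C (c 3) * X 3 with hz
  have hxh : x.IsHomogeneous 1 := isHomogeneous_C_mul_X _ _
  have hyh : y.IsHomogeneous 1 := isHomogeneous_C_mul_X _ _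
  have hzh : z.IsHomogeneous 1 := isHomogeneous_C_mul_X _ _
  have hpow : ∀ {u : MvPolynomial (Fin 4) K}, u.IsHomogeneous 1 →
      (u ^ (s + 1)).IsHomogeneous (s + 1) := fun {u} hu => by simpa using hu.pow (s + 1)
  have hfh := (((((hpow hxh).add (hpow hyh)).add (hpow hzh)).sub (hqhom hxh hyh)).sub
    (hqhom hyh hzh)).sub (hqhom hzh hxh)
  have hLf : linearForm c * (x ^ (s + 1) + y ^ (s + 1) + z ^ (s + 1) - x * y * q x y -
      y * z * q y z - z * x * q z x) ∈ I := by
    have : linearForm c * (x ^ (s + 1) + y ^ (s + 1) + z ^ (s + 1) - x * y * q x y -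
        y * z * q y z - z * x * q z x) =
        C (c 0) * (x ^ (s + 1) + y ^ (s + 1) + z ^ (s + 1) - x * y * q x y -
          y * z * q y z - z * x * q z x) * X 0 +
        C (c 1) ^ (s + 1 + 1) * X 1 ^ (s + 1 + 1) + C (c 2) ^ (s + 1 + 1) * X 2 ^ (s + 1 + 1) +
        C (c 3) ^ (s + 1 + 1) * X 3 ^ (s + 1 + 1) +
        -(C (c 1) * C (c 2) * C (c 3) * (q x y + q y z + q z x)) * (X 1 * X 2 * X 3) := by
      rw [← mul_pow, ← mul_pow, ← mul_pow, linearForm, Fin.sum_univ_four, ← hx, ← hy, ← hz]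
      have hxyz : C (c 1) * C (c 2) * C (c 3) * (q x y + q y z + q z x) * (X 1 * X 2 * X 3) =
          x * y * z * (q x y + q y z + q z x) := by
        rw [hx, hy, hz]; ring
      linear_combination hxyz - x * y * hqmul x y - y * z * hqmul y z - z * x * hqmul z x
    rw [this]
    exact add_mem (add_mem (add_mem (add_mem (I.mul_mem_left _ hX0) (I.mul_mem_left _ (hX 0)))
      (I.mul_mem_left _ (hX 1))) (I.mul_mem_left _ (hX 2))) (I.mul_mem_left _ hXXX)
  have hf := h _ hfh hLf
  -- If the kernel element were in `I`, its coefficients `c i ^ t` at the pure powers would vanish.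
  -- Then `L` would be a multiple of `w`, killing `x^t`, which is not in `I`.
  have hzero : ∀ {i j l : Fin 4} {k : K} {g g' : MvPolynomial (Fin 4) K}, i ≠ 0 → i ≠ j → i ≠ l →
      C k * X i ^ (s + 1) + X j * g + X l * g' ∈ I → k = 0 := fun hi hij hil hm => by
    have := coeff_eq_zero_of_mem hm (not_isInitialExponent_single hi)
    rwa [coeff_single_add_mul hij hil] at this
  have h1 : c 1 = 0 := by
    refine eq_zero_of_pow_eq_zero (n := s + 1) (hzero (i := 1) (j := 2) (l := 3)
      (g := C (c 2) * (y ^ s - x * q x y - z * q y z)) (g' := C (c 3) * (z ^ s - x * q z x))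
      (by decide) (by decide) (by decide) ?_)
    convert hf using 1
    rw [C_pow, ← mul_pow, ← hx]
    linear_combination -hy * (y ^ s - x * q x y - z * q y z) - hz * (z ^ s - x * q z x)
  have h2 : c 2 = 0 := by
    refine eq_zero_of_pow_eq_zero (n := s + 1) (hzero (i := 2) (j := 1) (l := 3)
      (g := C (c 1) * (x ^ s - y * q x y - z * q z x)) (g' := C (c 3) * (z ^ s - y * q y z))
      (by decide) (by decide) (by decide) ?_)
    convert hf using 1
    rw [C_pow, ← mul_pow, ← hy]
    linear_combination -hx * (x ^ s - y * q x y - z * q z x) - hz * (z ^ s - y * q y z)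
  have h3 : c 3 = 0 := by
    refine eq_zero_of_pow_eq_zero (n := s + 1) (hzero (i := 3) (j := 1) (l := 2)
      (g := C (c 1) * (x ^ s - y * q x y - z * q z x)) (g' := C (c 2) * (y ^ s - z * q y z))
      (by decide) (by decide) (by decide) ?_)
    convert hf using 1
    rw [C_pow, ← mul_pow, ← hz]
    linear_combination -hx * (x ^ s - y * q x y - z * q z x) - hy * (y ^ s - z * q y z)
  have hL : linearForm c * X 1 ^ (s + 1) ∈ I := by
    have : linearForm c = C (c 0) * X 0 := by
      simp [linearForm, Fin.sum_univ_four, h1, h2, h3]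
    rw [this]
    exact I.mul_mem_right _ (I.mul_mem_left _ hX0)
  have h4 := h _ (isHomogeneous_X_pow 1 (s + 1)) hL
  exact one_ne_zero (hzero (i := 1) (j := 2) (l := 3) (k := (1 : K)) (g := 0) (g' := 0)
    (by decide) (by decide) (by decide) (by simpa using h4))

theorem hasWLP_hyperplaneSection_X_zero_iff [Infinite K] {t : ℕ} (ht : 1 ≤ t) :
    HasWLP (hyperplaneSection (liftIdeal K t) (X 0)) ↔ Odd t ∧ ringChar K ≠ 2 := by
  refine ⟨fun h => ?_, fun h => hasWLP_hyperplaneSection_X_zero h.1 (Ring.two_ne_zero h.2)⟩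
  obtain ⟨L, hL, hWLP⟩ := hasWLP_iff.1 h
  obtain ⟨c, rfl⟩ := exists_eq_linearForm hL
  have hsign : (-1 : K) ^ t ≠ 1 := fun hs => (hWLP t).elim
    (not_injective_of_neg_one_pow_eq_one ht hs c) (not_surjective_of_neg_one_pow_eq_one ht hs c)
  constructor
  · by_contra hodd
    exact hsign (Nat.not_odd_iff_even.1 hodd).neg_one_pow
  · intro h2
    have : CharP K 2 := h2 ▸ ringChar.charP K
    exact hsign (by rw [CharTwo.neg_eq, one_pow])

/-! ### Non-zero-divisors and the points off which they stay. -/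

theorem vanishesOnCone_of_mem_liftIdeal {t : ℕ} {f : MvPolynomial (Fin 4) K}
    (hf : f ∈ liftIdeal K t) {p : Fin 4 → K} (hp : p ∈ gridBoundary K t) :
    VanishesOnCone f p := by
  obtain ⟨i, j, k, hi, hj, hk, hijk, rfl⟩ := hp
  refine vanishesOnCone_of_mem_span ?_ hf
  rintro g (rfl | rfl | rfl | rfl)
  · refine .of_isHomogeneous (isHomogeneous_gridProd _ 1) ?_
    rw [eval_gridProd]
    exact Finset.prod_eq_zero (Finset.mem_range.2 (Nat.lt_succ_of_le hi)) (by simp)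
  · refine .of_isHomogeneous (isHomogeneous_gridProd _ 2) ?_
    rw [eval_gridProd]
    exact Finset.prod_eq_zero (Finset.mem_range.2 (Nat.lt_succ_of_le hj)) (by simp)
  · refine .of_isHomogeneous (isHomogeneous_gridProd _ 3) ?_
    rw [eval_gridProd]
    exact Finset.prod_eq_zero (Finset.mem_range.2 (Nat.lt_succ_of_le hk)) (by simp)
  · refine .of_isHomogeneous (((isHomogeneous_X _ 1).mul (isHomogeneous_X _ 2)).mul
      (isHomogeneous_X _ 3)) ?_
    simp only [map_mul, eval_X, gridPoint_one, gridPoint_two, gridPoint_three]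
    exact_mod_cast congrArg (Nat.cast : ℕ → K) hijk

theorem mk_mem_nonZeroDivisors_iff {R : Type*} [CommRing R] {I : Ideal R} {h : R} :
    Ideal.Quotient.mk I h ∈ nonZeroDivisors (R ⧸ I) ↔ ∀ f, h * f ∈ I → f ∈ I := by
  rw [mem_nonZeroDivisors_iff_right]
  constructor
  · intro H f hf
    rw [← Ideal.Quotient.eq_zero_iff_mem] at hf ⊢
    refine H _ ?_
    rwa [← map_mul, mul_comm]
  · intro H x hx
    obtain ⟨f, rfl⟩ := Ideal.Quotient.mk_surjective x
    rw [← map_mul, mul_comm, Ideal.Quotient.eq_zero_iff_mem] at hx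
    exact Ideal.Quotient.eq_zero_iff_mem.2 (H f hx)

theorem exists_sub_mem_of_mem {σ : Type*} {I : Ideal (MvPolynomial σ K)} {h f : MvPolynomial σ K}
    (hf : f ∈ hyperplaneSection I h) : ∃ g, f - h * g ∈ I := by
  rw [hyperplaneSection, sup_comm] at hf
  obtain ⟨g, u, hu, rfl⟩ := Ideal.mem_span_singleton_sup.1 hf
  exact ⟨g, by rwa [mul_comm g, add_sub_cancel_left]⟩

section Reduced

variable [Infinite K] {t : ℕ}

theorem mem_liftIdeal_of_mul_mem
    (hinj : Set.InjOn (Nat.cast : ℕ → K) (Finset.range (t + 1))) {h : MvPolynomial (Fin 4) K}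
    (hh : h.IsHomogeneous 1) (hne : ∀ p ∈ gridBoundary K t, eval p h ≠ 0)
    {f : MvPolynomial (Fin 4) K} (hf : h * f ∈ liftIdeal K t) : f ∈ liftIdeal K t := by
  refine cutsOut_liftIdeal hinj f fun p hp a ha => ?_
  have := vanishesOnCone_of_mem_liftIdeal hf hp a ha
  rw [map_mul] at this
  exact (mul_eq_zero.1 this).resolve_left (eval_smul_ne_zero hh (hne p hp) ha)

/-- If `h` vanished at `p`, it would kill a form that separates `p` from the other grid points, and
that form is not in the ideal. -/
theorem eval_ne_zero_of_nonZeroDivisor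
    (hinj : Set.InjOn (Nat.cast : ℕ → K) (Finset.range (t + 1))) {h : MvPolynomial (Fin 4) K}
    (hh : h.IsHomogeneous 1) (hnzd : ∀ f, h * f ∈ liftIdeal K t → f ∈ liftIdeal K t)
    {p : Fin 4 → K} (hp : p ∈ gridBoundary K t) : eval p h ≠ 0 := by
  intro h0
  have hp' := hp
  obtain ⟨i, j, k, hi, hj, hk, -, rfl⟩ := hp'
  set A := Finset.range (t + 1)
  have hmem : ∀ {n}, n ≤ t → n ∈ A := fun hn => Finset.mem_range.2 (Nat.lt_succ_of_le hn)
  set f := gridProd K (A.erase i) 1 * gridProd K (A.erase j) 2 * gridProd K (A.erase k) 3 with hf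
  have hfh := ((isHomogeneous_gridProd (K := K) (A.erase i) 1).mul
    (isHomogeneous_gridProd (A.erase j) 2)).mul (isHomogeneous_gridProd (A.erase k) 3)
  have hne : ∀ {n}, n ≤ t → ∏ m ∈ A.erase n, ((n : K) - m * 1) ≠ 0 := fun {n} hn =>
    Finset.prod_ne_zero_iff.2 fun m hm he => by
      rw [mul_one, sub_eq_zero] at he
      exact Finset.ne_of_mem_erase hm (hinj (hmem hn) (Finset.mem_of_mem_erase hm) he).symm
  have hzero : ∀ {n n'}, n' ≤ t → n' ≠ n → ∏ m ∈ A.erase n, ((n' : K) - m * 1) = 0 :=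
    fun {n n'} hn' hnn => Finset.prod_eq_zero (Finset.mem_erase.2 ⟨hnn, hmem hn'⟩) (by simp)
  have hfI : f ∈ liftIdeal K t := by
    refine hnzd f (cutsOut_liftIdeal hinj _ fun q hq => .of_isHomogeneous (hh.mul hfh) ?_)
    obtain ⟨i', j', k', hi', hj', hk', -, rfl⟩ := hq
    by_cases h1 : i' = i
    · by_cases h2 : j' = j
      · by_cases h3 : k' = k
        · subst h1 h2 h3
          rw [map_mul, h0, zero_mul]
        · simp only [map_mul, eval_gridProd, gridPoint_zero, gridPoint_three, hzero hk' h3,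
            mul_zero]
      · simp only [map_mul, eval_gridProd, gridPoint_zero, gridPoint_two, hzero hj' h2,
          mul_zero, zero_mul]
    · simp only [map_mul, eval_gridProd, gridPoint_zero, gridPoint_one, hzero hi' h1,
        mul_zero, zero_mul]
  have := vanishesOnCone_of_mem_liftIdeal hfI hp 1 one_ne_zero
  rw [one_smul] at this
  simp only [hf, map_mul, eval_gridProd, gridPoint_zero, gridPoint_one, gridPoint_two,
    gridPoint_three] at this
  exact mul_ne_zero (mul_ne_zero (hne hi) (hne hj)) (hne hk) this

end Reduced

/-! ### The projective zero set, its cardinality and its homogeneous ideal. -/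

section ZeroLocus

theorem gridPoint_ne_zero (i j k : ℕ) : gridPoint K i j k ≠ 0 := fun h =>
  one_ne_zero (congrFun h 0 : (1 : K) = 0)

/-- The point `(1 : i : j : k)` of projective space. -/
def projGridPoint (K : Type*) [Field K] (m : ℕ × ℕ × ℕ) : ℙ K (Fin 4 → K) :=
  Projectivization.mk K (gridPoint K m.1 m.2.1 m.2.2) (gridPoint_ne_zero _ _ _)

/-- The triples of exponents at most `t` with at least one zero entry. -/
def boundaryTriples (t : ℕ) : Finset (ℕ × ℕ × ℕ) :=
  (Finset.range (t + 1) ×ˢ Finset.range (t + 1) ×ˢ Finset.range (t + 1)).filter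
    fun m => m.1 * m.2.1 * m.2.2 = 0

theorem mem_boundaryTriples {t i j k : ℕ} : (i, j, k) ∈ boundaryTriples t ↔
    i ≤ t ∧ j ≤ t ∧ k ≤ t ∧ i * j * k = 0 := by
  simp [boundaryTriples, and_assoc]

/-- The complement in the cube consists of the triples of positive entries, so the count is `(t+1)^3
- t^3`. -/
theorem card_boundaryTriples (t : ℕ) : (boundaryTriples t).card = 3 * t * (t + 1) + 1 := by
  set A := Finset.range (t + 1)
  have h1 := Finset.card_filter_add_card_filter_not (s := A ×ˢ A ×ˢ A)
    (fun m : ℕ × ℕ × ℕ => m.1 * m.2.1 * m.2.2 = 0)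
  have h2 : (A ×ˢ A ×ˢ A).filter (fun m : ℕ × ℕ × ℕ => ¬ m.1 * m.2.1 * m.2.2 = 0) =
      Finset.Icc 1 t ×ˢ Finset.Icc 1 t ×ˢ Finset.Icc 1 t := by
    ext ⟨i, j, k⟩
    simp only [A, Finset.mem_filter, Finset.mem_product, Finset.mem_range, Finset.mem_Icc,
      mul_eq_zero, not_or]
    omega
  rw [h2] at h1
  simp only [Finset.card_product, Nat.card_Icc, A, Finset.card_range, add_tsub_cancel_right] at h1
  change (boundaryTriples t).card + _ = _ at h1
  have h3 : (t + 1) * ((t + 1) * (t + 1)) = 3 * t * (t + 1) + 1 + t * (t * t) := by ring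
  omega

theorem projZeroLocus_liftIdeal (t : ℕ) :
    projZeroLocus (liftIdeal K t) = projGridPoint K '' (boundaryTriples t : Set (ℕ × ℕ × ℕ)) := by
  ext p
  constructor
  · intro hp
    have hv := p.rep_nonzero
    set v := p.rep with hvdef
    have hF : ∀ s : Fin 3, ∃ n ≤ t, v s.succ = n * v 0 := fun s => by
      have h : eval v _ = 0 := hp _ (gridProd_mem_liftIdeal t s) _ (isHomogeneous_gridProd _ _)
      rw [eval_gridProd, Finset.prod_eq_zero_iff] at h
      obtain ⟨n, hn, h⟩ := h
      exact ⟨n, Nat.lt_succ_iff.1 (Finset.mem_range.1 hn), sub_eq_zero.1 h⟩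
    have hxyz : eval v (X 1 * X 2 * X 3) = 0 := hp _ (X_mul_X_mul_X_mem_liftIdeal t) _
      (((isHomogeneous_X _ _).mul (isHomogeneous_X _ _)).mul (isHomogeneous_X _ _))
    obtain ⟨i, j, k, hi, hj, hk, hijk, h1, h2, h3⟩ : ∃ i j k : ℕ, i ≤ t ∧ j ≤ t ∧ k ≤ t ∧
        i * j * k = 0 ∧ v 1 = i * v 0 ∧ v 2 = j * v 0 ∧ v 3 = k * v 0 := by
      obtain ⟨i, hi, hi'⟩ := hF 0
      obtain ⟨j, hj, hj'⟩ := hF 1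
      obtain ⟨k, hk, hk'⟩ := hF 2
      simp only [map_mul, eval_X, mul_eq_zero] at hxyz
      rcases hxyz with (h | h) | h
      · exact ⟨0, j, k, t.zero_le, hj, hk, by simp, by simpa using h, hj', hk'⟩
      · exact ⟨i, 0, k, hi, t.zero_le, hk, by simp, hi', by simpa using h, hk'⟩
      · exact ⟨i, j, 0, hi, hj, t.zero_le, by simp, hi', hj', by simpa using h⟩
    have hveq : v 0 • gridPoint K i j k = v := by
      ext m
      fin_cases m
      · simp
      · simpa [mul_comm] using h1.symm
      · simpa [mul_comm] using h2.symm
      · simpa [mul_comm] using h3.symm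
    refine ⟨(i, j, k), mem_boundaryTriples.2 ⟨hi, hj, hk, hijk⟩, ?_⟩
    rw [← p.mk_rep, projGridPoint]
    have hv0 : v 0 ≠ 0 := fun h0 => hv (by rw [← hveq, h0, zero_smul])
    exact ((Projectivization.mk_eq_mk_iff' K _ _ _ _).2 ⟨v 0, hveq⟩).symm
  · rintro ⟨⟨i, j, k⟩, hm, rfl⟩ f hf n hn
    obtain ⟨hi, hj, hk, hijk⟩ := mem_boundaryTriples.1 hm
    rw [projGridPoint, vanishesAt_mk_iff hn]
    have := vanishesOnCone_of_mem_liftIdeal hf ⟨i, j, k, hi, hj, hk, hijk, rfl⟩ 1 one_ne_zero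
    rwa [one_smul] at this

theorem ncard_projZeroLocus_liftIdeal {t : ℕ}
    (hinj : Set.InjOn (Nat.cast : ℕ → K) (Finset.range (t + 1))) :
    (projZeroLocus (liftIdeal K t)).ncard = 3 * t * (t + 1) + 1 := by
  rw [projZeroLocus_liftIdeal, Set.InjOn.ncard_image, Set.ncard_coe_finset,
    card_boundaryTriples]
  rintro ⟨i, j, k⟩ hm ⟨i', j', k'⟩ hm' he
  obtain ⟨hi, hj, hk, -⟩ := mem_boundaryTriples.1 hm
  obtain ⟨hi', hj', hk', -⟩ := mem_boundaryTriples.1 hm'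
  obtain ⟨a, ha⟩ := (Projectivization.mk_eq_mk_iff' K _ _ _ _).1 he
  have ha1 : a = 1 := by simpa using congrFun ha 0
  subst ha1
  rw [one_smul] at ha
  have hmem : ∀ {n}, n ≤ t → n ∈ (Finset.range (t + 1) : Set ℕ) := fun hn => by
    simpa [Nat.lt_succ_iff] using hn
  have h1 := hinj (hmem hi') (hmem hi) (congrFun ha 1)
  have h2 := hinj (hmem hj') (hmem hj) (congrFun ha 2)
  have h3 := hinj (hmem hk') (hmem hk) (congrFun ha 3)
  rw [h1, h2, h3]

theorem projVanishingIdeal_projZeroLocus_liftIdeal [Infinite K] {t : ℕ}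
    (hinj : Set.InjOn (Nat.cast : ℕ → K) (Finset.range (t + 1))) :
    projVanishingIdeal (projZeroLocus (liftIdeal K t)) = liftIdeal K t := by
  apply le_antisymm
  · refine Ideal.span_le.2 ?_
    rintro f ⟨⟨n, hn⟩, hf⟩
    refine cutsOut_liftIdeal hinj f ?_
    rintro q ⟨i, j, k, hi, hj, hk, hijk, rfl⟩
    refine .of_isHomogeneous hn ((vanishesAt_mk_iff hn _ (gridPoint_ne_zero i j k)).1 (hf _ ?_))
    rw [projZeroLocus_liftIdeal]
    exact ⟨(i, j, k), mem_boundaryTriples.2 ⟨hi, hj, hk, hijk⟩, rfl⟩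
  · have hsub : ∀ {f : MvPolynomial (Fin 4) K} {n : ℕ}, f.IsHomogeneous n → f ∈ liftIdeal K t →
        f ∈ projVanishingIdeal (projZeroLocus (liftIdeal K t)) := fun {f n} hn hf =>
      Ideal.subset_span ⟨⟨n, hn⟩, fun p hp => hp f hf n hn⟩
    refine Ideal.span_le.2 ?_
    rintro f (rfl | rfl | rfl | rfl)
    · exact hsub (isHomogeneous_gridProd _ 1) (gridProd_mem_liftIdeal t 0)
    · exact hsub (isHomogeneous_gridProd _ 2) (gridProd_mem_liftIdeal t 1)
    · exact hsub (isHomogeneous_gridProd _ 3) (gridProd_mem_liftIdeal t 2)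
    · exact hsub (((isHomogeneous_X _ _).mul (isHomogeneous_X _ _)).mul (isHomogeneous_X _ _))
        (X_mul_X_mul_X_mem_liftIdeal t)

end ZeroLocus

/-! ### The socle of the Artinian reductions. -/

section Socle

/-- Forms whose classes span the socle of every Artinian reduction of `R / liftIdeal K t`. -/
def socleForm (K : Type*) [Field K] (t : ℕ) : Fin 3 → MvPolynomial (Fin 4) K :=
  ![gridProd K (Finset.range t) 2 * gridProd K (Finset.range t) 3,
    gridProd K (Finset.range t) 1 * gridProd K (Finset.range t) 3,
    gridProd K (Finset.range t) 1 * gridProd K (Finset.range t) 2]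

/-- The exponents of the residues of `socleForm K t` modulo `w`. -/
def socleExponent (t : ℕ) : Fin 3 → Fin 4 →₀ ℕ :=
  ![Finsupp.single 2 t + Finsupp.single 3 t, Finsupp.single 1 t + Finsupp.single 3 t,
    Finsupp.single 1 t + Finsupp.single 2 t]

/-- The only zeros of `liftIdeal K t` where the corresponding `socleForm K t` does not vanish. -/
def corner (K : Type*) [Field K] (t : ℕ) : Fin 3 → Fin 4 → K :=
  ![gridPoint K 0 t t, gridPoint K t 0 t, gridPoint K t t 0]

theorem corner_mem (t : ℕ) (s : Fin 3) : corner K t s ∈ gridBoundary K t := by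
  fin_cases s
  · exact ⟨0, t, t, t.zero_le, le_rfl, le_rfl, by simp, rfl⟩
  · exact ⟨t, 0, t, le_rfl, t.zero_le, le_rfl, by simp, rfl⟩
  · exact ⟨t, t, 0, le_rfl, le_rfl, t.zero_le, by simp, rfl⟩

theorem corner_zero (t : ℕ) (s : Fin 3) : corner K t s 0 = 1 := by
  fin_cases s <;> rfl

theorem isHomogeneous_socleForm (t : ℕ) (s : Fin 3) :
    (socleForm K t s).IsHomogeneous (t + t) := by
  have h : ∀ i, (gridProd K (Finset.range t) i).IsHomogeneous t := fun i => by
    simpa using isHomogeneous_gridProd (K := K) (Finset.range t) i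
  fin_cases s
  · exact (h 2).mul (h 3)
  · exact (h 1).mul (h 3)
  · exact (h 1).mul (h 2)

theorem socleForm_sub_monomial_mem (t : ℕ) (s : Fin 3) :
    socleForm K t s - monomial (socleExponent t s) 1 ∈
      hyperplaneSection (liftIdeal K t) (X 0) := by
  have h : ∀ i j : Fin 4, gridProd K (Finset.range t) i * gridProd K (Finset.range t) j -
      monomial (Finsupp.single i t + Finsupp.single j t) 1 ∈
        hyperplaneSection (liftIdeal K t) (X 0) := fun i j => by
    refine Ideal.mem_sup_right ?_
    have hi := gridProd_sub_X_pow_mem (K := K) (Finset.range t) i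
    have hj := gridProd_sub_X_pow_mem (K := K) (Finset.range t) j
    rw [Finset.card_range] at hi hj
    have hm : monomial (Finsupp.single i t + Finsupp.single j t) (1 : K) = X i ^ t * X j ^ t := by
      rw [X_pow_eq_monomial, X_pow_eq_monomial, monomial_mul, one_mul]
    rw [hm]
    have := add_mem (Ideal.mul_mem_right (gridProd K (Finset.range t) j) _ hi)
      (Ideal.mul_mem_left _ (X i ^ t) hj)
    convert this using 1
    ring
  fin_cases s
  · exact h 2 3
  · exact h 1 3
  · exact h 1 2

theorem socleExponent_injective {t : ℕ} (ht : 1 ≤ t) : Function.Injective (socleExponent t) := by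
  have h : ∀ s s', socleExponent t s s'.succ = if s = s' then 0 else t := fun s s' => by
    fin_cases s <;> fin_cases s' <;> simp [socleExponent]
  intro s s' he
  by_contra hne
  have := DFunLike.congr_fun he s.succ
  rw [h, h, if_pos rfl, if_neg (Ne.symm hne)] at this
  omega

theorem not_isInitialExponent_socleExponent {t : ℕ} (s : Fin 3) :
    ¬ IsInitialExponent t (socleExponent t s) := by
  fin_cases s <;> simp [IsInitialExponent, socleExponent]

theorem exists_eq_socleExponent {t : ℕ} (ht : 1 ≤ t) {m : Fin 4 →₀ ℕ}
    (hm : ¬ IsInitialExponent t m) (h : ∀ i, IsInitialExponent t (Finsupp.single i 1 + m)) :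
    ∃ s, m = socleExponent t s := by
  have h1 := h 1
  have h2 := h 2
  have h3 := h 3
  simp [IsInitialExponent] at hm h1 h2 h3
  have h4 : m 0 = 0 ∧ ((m 1 = 0 ∧ m 2 = t ∧ m 3 = t) ∨ (m 1 = t ∧ m 2 = 0 ∧ m 3 = t) ∨
      (m 1 = t ∧ m 2 = t ∧ m 3 = 0)) := by omega
  obtain ⟨h0, ⟨h1, h2, h3⟩ | ⟨h1, h2, h3⟩ | ⟨h1, h2, h3⟩⟩ := h4
  · refine ⟨0, Finsupp.ext fun i => ?_⟩
    fin_cases i <;> simp [socleExponent, h0, h1, h2, h3]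
  · refine ⟨1, Finsupp.ext fun i => ?_⟩
    fin_cases i <;> simp [socleExponent, h0, h1, h2, h3]
  · refine ⟨2, Finsupp.ext fun i => ?_⟩
    fin_cases i <;> simp [socleExponent, h0, h1, h2, h3]

theorem coeff_sum_socleExponent {t : ℕ} (ht : 1 ≤ t) (a : Fin 3 → K) (s : Fin 3) :
    coeff (socleExponent t s) (∑ s', monomial (socleExponent t s') (a s')) = a s := by
  classical
  rw [coeff_sum, Finset.sum_eq_single s]
  · simp
  · intro s' _ hs'
    rw [coeff_monomial, if_neg fun he => hs' (socleExponent_injective ht he)]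
  · simp

theorem sum_socleForm_sub_mem (t : ℕ) (a : Fin 3 → K) :
    ∑ s, C (a s) * socleForm K t s - ∑ s, monomial (socleExponent t s) (a s) ∈
      hyperplaneSection (liftIdeal K t) (X 0) := by
  rw [← Finset.sum_sub_distrib]
  refine Ideal.sum_mem _ fun s _ => ?_
  have := Ideal.mul_mem_left _ (C (a s)) (socleForm_sub_monomial_mem (K := K) t s)
  rwa [mul_sub, C_mul_monomial, mul_one] at this

theorem eq_zero_of_sum_socleForm_mem {t : ℕ} (ht : 1 ≤ t) {a : Fin 3 → K}
    (h : ∑ s, C (a s) * socleForm K t s ∈ hyperplaneSection (liftIdeal K t) (X 0)) (s : Fin 3) :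
    a s = 0 := by
  have h1 := sub_mem h (sum_socleForm_sub_mem t a)
  rw [sub_sub_cancel] at h1
  rw [← coeff_sum_socleExponent ht a s]
  exact coeff_eq_zero_of_mem h1 (not_isInitialExponent_socleExponent s)

/-- The ideal at `w = 0` is monomial, so each monomial of `f` outside it must itself be killed by
all variables; the only such monomials are those of `socleExponent`. -/
theorem exists_sub_sum_socleForm_mem {t : ℕ} (ht : 1 ≤ t) {f : MvPolynomial (Fin 4) K}
    (hf : ∀ i, X i * f ∈ hyperplaneSection (liftIdeal K t) (X 0)) :
    ∃ a : Fin 3 → K, f - ∑ s, C (a s) * socleForm K t s ∈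
      hyperplaneSection (liftIdeal K t) (X 0) := by
  set a : Fin 3 → K := fun s => coeff (socleExponent t s) f with ha
  refine ⟨a, ?_⟩
  have h1 : f - ∑ s, monomial (socleExponent t s) (a s) ∈
      hyperplaneSection (liftIdeal K t) (X 0) := by
    refine mem_hyperplaneSection_X_zero_iff.2 fun m hm => ?_
    by_contra hin
    by_cases hs : ∃ s, m = socleExponent t s
    · obtain ⟨s, rfl⟩ := hs
      rw [coeff_sub, coeff_sum_socleExponent ht, ha] at hm
      exact hm (sub_self _)
    · have hz : coeff m (∑ s, monomial (socleExponent t s) (a s)) = 0 := by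
        classical
        rw [coeff_sum]
        exact Finset.sum_eq_zero fun s _ => by
          rw [coeff_monomial, if_neg fun he => hs ⟨s, he.symm⟩]
      rw [coeff_sub, hz, sub_zero] at hm
      refine hs (exists_eq_socleExponent ht hin fun i => ?_)
      refine mem_hyperplaneSection_X_zero_iff.1 (hf i) _ ?_
      rwa [coeff_X_mul]
  have := sub_mem h1 (sum_socleForm_sub_mem t a)
  rwa [sub_sub_sub_cancel_right] at this

/-- Away from its corner `socleForm K t s` already vanishes on the boundary points, and `f` takes
care of the corner. -/
theorem mul_socleForm_mem [Infinite K] {t : ℕ} (ht : 1 ≤ t)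
    (hinj : Set.InjOn (Nat.cast : ℕ → K) (Finset.range (t + 1))) (s : Fin 3)
    {f : MvPolynomial (Fin 4) K} {n : ℕ} (hf : f.IsHomogeneous n)
    (h0 : eval (corner K t s) f = 0) : f * socleForm K t s ∈ liftIdeal K t := by
  refine cutsOut_liftIdeal hinj _ fun q hq =>
    .of_isHomogeneous (hf.mul (isHomogeneous_socleForm t s)) ?_
  obtain ⟨i, j, k, hi, hj, hk, hijk, rfl⟩ := hq
  have hG : ∀ {n}, n ≤ t → n ≠ t → ∏ m ∈ Finset.range t, ((n : K) - m * 1) = 0 := fun hn hne =>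
    Finset.prod_eq_zero (Finset.mem_range.2 (lt_of_le_of_ne hn hne)) (by simp)
  have hmul : ∀ {a b : ℕ}, a = t → b = t → a * b ≠ 0 := fun ha hb => by
    rw [ha, hb]
    exact mul_ne_zero (by omega) (by omega)
  rw [map_mul, mul_eq_zero, or_iff_not_imp_right]
  intro hne
  fin_cases s
  · change eval _ (gridProd K _ 2 * gridProd K _ 3) ≠ 0 at hne
    rw [map_mul, eval_gridProd, eval_gridProd, mul_ne_zero_iff] at hne
    have h1 : j = t := not_not.1 fun h => hne.1 (hG hj h)
    have h2 : k = t := not_not.1 fun h => hne.2 (hG hk h)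
    rw [mul_assoc] at hijk
    have h3 : i = 0 := (mul_eq_zero.1 hijk).resolve_right (hmul h1 h2)
    rw [h1, h2, h3]
    exact h0
  · change eval _ (gridProd K _ 1 * gridProd K _ 3) ≠ 0 at hne
    rw [map_mul, eval_gridProd, eval_gridProd, mul_ne_zero_iff] at hne
    have h1 : i = t := not_not.1 fun h => hne.1 (hG hi h)
    have h2 : k = t := not_not.1 fun h => hne.2 (hG hk h)
    rw [mul_right_comm] at hijk
    have h3 : j = 0 := (mul_eq_zero.1 hijk).resolve_left (hmul h1 h2)
    rw [h1, h2, h3]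
    exact h0
  · change eval _ (gridProd K _ 1 * gridProd K _ 2) ≠ 0 at hne
    rw [map_mul, eval_gridProd, eval_gridProd, mul_ne_zero_iff] at hne
    have h1 : i = t := not_not.1 fun h => hne.1 (hG hi h)
    have h2 : j = t := not_not.1 fun h => hne.2 (hG hj h)
    have h3 : k = 0 := (mul_eq_zero.1 hijk).resolve_left (hmul h1 h2)
    rw [h1, h2, h3]
    exact h0

theorem mk_mem_socle {σ : Type*} {J : Ideal (MvPolynomial σ K)} {f : MvPolynomial σ K} :
    Ideal.Quotient.mk J f ∈ socle J ↔ ∀ i, X i * f ∈ J := by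
  simp only [socle, Submodule.mem_iInf, LinearMap.mem_ker, LinearMap.mulLeft_apply, ← map_mul,
    Ideal.Quotient.eq_zero_iff_mem]

/-- On `socleForm K t s` the form `h` acts as `κ w`, where `κ` is its value at the corner, because
`h - κ w` vanishes there. This relates the reductions by `h` and by `w`. -/
theorem mul_sum_socleForm_sub_mem [Infinite K] {t : ℕ} (ht : 1 ≤ t)
    (hinj : Set.InjOn (Nat.cast : ℕ → K) (Finset.range (t + 1))) {h : MvPolynomial (Fin 4) K}
    (hh : h.IsHomogeneous 1) (a : Fin 3 → K) :
    h * ∑ s, C (a s) * socleForm K t s -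
      X 0 * ∑ s, C (eval (corner K t s) h * a s) * socleForm K t s ∈ liftIdeal K t := by
  rw [Finset.mul_sum, Finset.mul_sum, ← Finset.sum_sub_distrib]
  refine Ideal.sum_mem _ fun s _ => ?_
  have := Ideal.mul_mem_left _ (C (a s)) (mul_socleForm_mem ht hinj s
    (hh.sub (isHomogeneous_C_mul_X (eval (corner K t s) h) 0)) (by simp [corner_zero]))
  convert this using 1
  rw [C_mul]
  ring

theorem socleForm_mem_socle [Infinite K] {t : ℕ} (ht : 1 ≤ t)
    (hinj : Set.InjOn (Nat.cast : ℕ → K) (Finset.range (t + 1))) {h : MvPolynomial (Fin 4) K}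
    (hh : h.IsHomogeneous 1) (hne : ∀ p ∈ gridBoundary K t, eval p h ≠ 0)
    (s : Fin 3) : Ideal.Quotient.mk (hyperplaneSection (liftIdeal K t) h)
    (socleForm K t s) ∈ socle (hyperplaneSection (liftIdeal K t) h) := by
  set κ := eval (corner K t s) h with hκ
  have hκ0 : κ ≠ 0 := hne _ (corner_mem t s)
  have hw : X 0 * socleForm K t s ∈ hyperplaneSection (liftIdeal K t) h := by
    have h1 : (h - C κ * X 0) * socleForm K t s ∈ hyperplaneSection (liftIdeal K t) h :=
      Ideal.mem_sup_left (mul_socleForm_mem ht hinj s (hh.sub (isHomogeneous_C_mul_X κ 0))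
        (by simp [corner_zero, hκ]))
    have h2 : h * socleForm K t s ∈ hyperplaneSection (liftIdeal K t) h :=
      Ideal.mul_mem_right _ _ (Ideal.mem_sup_right (Ideal.mem_span_singleton_self _))
    have h3 := Ideal.mul_mem_left _ (C κ⁻¹) (sub_mem h2 h1)
    convert h3 using 1
    have : (C κ⁻¹ * C κ : MvPolynomial (Fin 4) K) = 1 := by
      rw [← C_mul, inv_mul_cancel₀ hκ0, C_1]
    linear_combination -(X 0 * socleForm K t s) * this
  refine mk_mem_socle.2 fun i => ?_
  have h1 : (X i - C (corner K t s i) * X 0) * socleForm K t s ∈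
      hyperplaneSection (liftIdeal K t) h :=
    Ideal.mem_sup_left (mul_socleForm_mem ht hinj s (isHomogeneous_X_sub i _)
      (by simp [corner_zero]))
  convert add_mem h1 (Ideal.mul_mem_left _ (C (corner K t s i)) hw) using 1
  ring

/-- If `∑ a_s σ_s ≡ h u` modulo the ideal, then `h ∑ (a_s/κ_s) σ_s ≡ w ∑ a_s σ_s ≡ w h u`.
Cancelling `h` yields a relation modulo `w`, where the monomials are independent. -/
theorem linearIndependent_socleForm [Infinite K] {t : ℕ} (ht : 1 ≤ t)
    (hinj : Set.InjOn (Nat.cast : ℕ → K) (Finset.range (t + 1))) {h : MvPolynomial (Fin 4) K}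
    (hh : h.IsHomogeneous 1) (hne : ∀ p ∈ gridBoundary K t, eval p h ≠ 0) :
    LinearIndependent K fun s =>
    Ideal.Quotient.mk (hyperplaneSection (liftIdeal K t) h) (socleForm K t s) := by
  refine Fintype.linearIndependent_iff.2 fun a ha s => ?_
  have h1 : ∑ s, C (a s) * socleForm K t s ∈ hyperplaneSection (liftIdeal K t) h := by
    rw [← Ideal.Quotient.eq_zero_iff_mem, map_sum, ← ha]
    refine Finset.sum_congr rfl fun s _ => ?_
    rw [← smul_eq_C_mul]
    rfl
  obtain ⟨u, hu⟩ := exists_sub_mem_of_mem h1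
  set κ := fun s => eval (corner K t s) h with hκ
  have hκ0 : ∀ s, κ s ≠ 0 := fun s => hne _ (corner_mem t s)
  have h2 := mul_sum_socleForm_sub_mem ht hinj hh fun s => a s / κ s
  have h3 : ∀ s, eval (corner K t s) h * (a s / κ s) = a s := fun s => mul_div_cancel₀ _ (hκ0 s)
  simp only [h3] at h2
  have h4 : h * (∑ s, C (a s / κ s) * socleForm K t s - u * X 0) ∈ liftIdeal K t := by
    convert add_mem h2 (Ideal.mul_mem_left _ (X 0) hu) using 1
    ring
  have h5 := mem_liftIdeal_of_mul_mem hinj hh hne h4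
  have h6 : ∑ s, C (a s / κ s) * socleForm K t s ∈ hyperplaneSection (liftIdeal K t) (X 0) := by
    have := add_mem (Ideal.mem_sup_left h5) (Ideal.mem_sup_right
      (Ideal.mul_mem_left _ u (Ideal.mem_span_singleton_self (X 0))) :
      u * X 0 ∈ liftIdeal K t ⊔ Ideal.span {X 0})
    rwa [sub_add_cancel] at this
  exact (div_eq_zero_iff.1 (eq_zero_of_sum_socleForm_mem ht h6 s)).resolve_right (hκ0 s)

theorem socle_eq_span [Infinite K] {t : ℕ} (ht : 1 ≤ t)
    (hinj : Set.InjOn (Nat.cast : ℕ → K) (Finset.range (t + 1))) {h : MvPolynomial (Fin 4) K}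
    (hh : h.IsHomogeneous 1) (hne : ∀ p ∈ gridBoundary K t, eval p h ≠ 0) :
    socle (hyperplaneSection (liftIdeal K t) h) =
    Submodule.span K (Set.range fun s =>
      Ideal.Quotient.mk (hyperplaneSection (liftIdeal K t) h) (socleForm K t s)) := by
  apply le_antisymm
  · intro x hx
    obtain ⟨f, rfl⟩ := Ideal.Quotient.mk_surjective x
    choose g hg using fun i => exists_sub_mem_of_mem (mk_mem_socle.1 hx i)
    have hw : ∀ p ∈ gridBoundary K t, eval p (X 0) ≠ 0 := by
      rintro p ⟨i, j, k, -, -, -, -, rfl⟩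
      simp
    -- From `X_i f ≡ h g_i`, comparing `w X_i f` in two ways and cancelling `h` gives `X_i g_0 ≡ w
    -- g_i`, so `g_0` is a socle element modulo `w`.
    have h1 : ∀ i, X i * g 0 ∈ hyperplaneSection (liftIdeal K t) (X 0) := fun i => by
      have h2 : h * (X i * g 0 - g i * X 0) ∈ liftIdeal K t := by
        convert sub_mem (Ideal.mul_mem_left _ (X 0) (hg i)) (Ideal.mul_mem_left _ (X i) (hg 0))
          using 1
        ring
      have h3 := mem_liftIdeal_of_mul_mem hinj hh hne h2
      have := add_mem (Ideal.mem_sup_left h3) (Ideal.mem_sup_right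
        (Ideal.mul_mem_left _ (g i) (Ideal.mem_span_singleton_self (X 0))) :
        g i * X 0 ∈ liftIdeal K t ⊔ Ideal.span {X 0})
      rwa [sub_add_cancel] at this
    obtain ⟨a, ha⟩ := exists_sub_sum_socleForm_mem ht h1
    obtain ⟨u, hu⟩ := exists_sub_mem_of_mem ha
    have h4 := mul_sum_socleForm_sub_mem ht hinj hh a
    set κ := fun s => eval (corner K t s) h with hκ
    have h5 : X 0 * (f - ∑ s, C (κ s * a s) * socleForm K t s - u * h) ∈ liftIdeal K t := by
      convert add_mem (add_mem (hg 0) h4) (Ideal.mul_mem_left _ h hu) using 1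
      ring
    -- Cancelling `w` instead of `h` carries the expansion of `g 0` back to one of `f`, with
    -- coefficients scaled by `κ`.
    have h6 := mem_liftIdeal_of_mul_mem hinj (isHomogeneous_X _ _) hw h5
    have h7 : Ideal.Quotient.mk (hyperplaneSection (liftIdeal K t) h) f =
        Ideal.Quotient.mk _ (∑ s, C (κ s * a s) * socleForm K t s) := by
      refine Ideal.Quotient.eq.2 ?_
      have := add_mem (Ideal.mem_sup_left h6) (Ideal.mem_sup_right
        (Ideal.mul_mem_left _ u (Ideal.mem_span_singleton_self h)) :
        u * h ∈ liftIdeal K t ⊔ Ideal.span {h})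
      rwa [sub_add_cancel] at this
    rw [h7, map_sum]
    refine Submodule.sum_mem _ fun s _ => ?_
    have hs := Submodule.smul_mem _ (κ s * a s) (Submodule.subset_span (R := K)
      (Set.mem_range_self (f := fun s => Ideal.Quotient.mk (hyperplaneSection (liftIdeal K t) h)
        (socleForm K t s)) s))
    rw [← smul_eq_C_mul]
    exact hs
  · rw [Submodule.span_le]
    rintro _ ⟨s, rfl⟩
    exact socleForm_mem_socle ht hinj hh hne s

theorem isArtinianLevel_hyperplaneSection [Infinite K] {t : ℕ} (ht : 1 ≤ t)
    (hinj : Set.InjOn (Nat.cast : ℕ → K) (Finset.range (t + 1))) {h : MvPolynomial (Fin 4) K}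
    (hh : h.IsHomogeneous 1) (hne : ∀ p ∈ gridBoundary K t, eval p h ≠ 0) :
    IsArtinianLevel (hyperplaneSection (liftIdeal K t) h) 3 := by
  refine ⟨?_, ?_, t + t, ?_⟩
  · obtain ⟨c, rfl⟩ := exists_eq_linearForm hh
    exact isArtinianRing_hyperplaneSection hne
  · rw [socle_eq_span ht hinj hh hne,
      finrank_span_eq_card (linearIndependent_socleForm ht hinj hh hne), Fintype.card_fin]
  · rw [socle_eq_span ht hinj hh hne, Submodule.span_le]
    rintro _ ⟨s, rfl⟩
    exact ⟨socleForm K t s, isHomogeneous_socleForm t s, rfl⟩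

end Socle

/-! ### Levelness of the point set, and the role of the characteristic. -/

theorem isLevelPointSet_projZeroLocus_liftIdeal [Infinite K] {t : ℕ} (ht : 1 ≤ t)
    (hinj : Set.InjOn (Nat.cast : ℕ → K) (Finset.range (t + 1))) :
    IsLevelPointSet (projZeroLocus (liftIdeal K t)) 3 := by
  have hI := projVanishingIdeal_projZeroLocus_liftIdeal hinj
  refine ⟨?_, ⟨X 0, isHomogeneous_X _ _, mk_mem_nonZeroDivisors_iff.2 fun f hf => ?_⟩,
    fun h hh hnzd => ?_⟩
  · rw [projZeroLocus_liftIdeal]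
    exact (Finset.finite_toSet _).image _
  · rw [hI] at hf ⊢
    refine mem_liftIdeal_of_mul_mem hinj (isHomogeneous_X _ _) ?_ hf
    rintro p ⟨i, j, k, -, -, -, -, rfl⟩
    simp
  · replace hnzd := mk_mem_nonZeroDivisors_iff.1 hnzd
    rw [hI] at hnzd ⊢
    exact isArtinianLevel_hyperplaneSection ht hinj hh fun p hp =>
      eval_ne_zero_of_nonZeroDivisor hinj hh hnzd hp

theorem natCast_injOn_range {t : ℕ} (h : ringChar K = 0 ∨ t < ringChar K) :
    Set.InjOn (Nat.cast : ℕ → K) (Finset.range (t + 1)) := by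
  rcases h with h | h
  · have : CharP K 0 := h ▸ ringChar.charP K
    have := CharP.charP_to_charZero K
    exact Nat.cast_injective.injOn
  · refine (CharP.natCast_injOn_Iio K (ringChar K)).mono fun n hn => ?_
    have := Finset.mem_range.1 (Finset.mem_coe.1 hn)
    exact Set.mem_Iio.2 (by omega)

end LevelLefschetz

end

theorem corollary3p7 (K : Type*) [Field K] [Infinite K] (t : ℕ) (ht : 1 ≤ t) :
    -- (i) the ideal is the full homogeneous ideal of a level set of points of type three
    ((ringChar K = 0 ∨ t < ringChar K) →
      (projZeroLocus (liftIdeal K t)).ncard = 3 * t * (t + 1) + 1 ∧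
      projVanishingIdeal (projZeroLocus (liftIdeal K t)) = liftIdeal K t ∧
      IsLevelPointSet (projZeroLocus (liftIdeal K t)) 3) ∧
    -- (ii) general hyperplane sections
    ForGeneralLinearForm (fun ℓ : MvPolynomial (Fin 4) K =>
      IsArtinianRing (MvPolynomial (Fin 4) K ⧸ hyperplaneSection (liftIdeal K t) ℓ) ∧
      HasWLP (hyperplaneSection (liftIdeal K t) ℓ)) ∧
    -- (iii) the special hyperplane section `w = 0`
    (IsArtinianRing
        (MvPolynomial (Fin 4) K ⧸ hyperplaneSection (liftIdeal K t) (MvPolynomial.X 0)) ∧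
      (HasWLP (hyperplaneSection (liftIdeal K t) (MvPolynomial.X 0)) ↔
        Odd t ∧ ringChar K ≠ 2)) :=
  ⟨fun h => ⟨ncard_projZeroLocus_liftIdeal (natCast_injOn_range h),
      projVanishingIdeal_projZeroLocus_liftIdeal (natCast_injOn_range h),
      isLevelPointSet_projZeroLocus_liftIdeal ht (natCast_injOn_range h)⟩,
    forGeneralLinearForm_hasWLP ht, isArtinianRing_hyperplaneSection_X_zero t,
    hasWLP_hyperplaneSection_X_zero_iff ht⟩
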